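/- Let $d\ge 2$. A channel is a completely positive trace-preserving linear map between operator spaces of finite-dimensional Hilbert spaces; for a matrix $U$ write $\mathcal U(\rho)=U\rho U^\dagger$. Let $W\in U(d)$ be a fixed unitary and let $\theta(C)=WC^TW^\dagger$ (so $\theta$ is unitarily equivalent to the transpose; $W=I$ gives the transpose itself). The input-output inversion $\Theta$ is the linear map sending the map with Kraus operators $(C_i)$ to the map with Kraus operators $(\theta(C_i))$, and the quantum time flip $\mathcal F$ is the linear map sending the map on $\mathbb C^d$ with Kraus operators $(C_i)$ to the map on $\mathbb C^d\otimes\mathbb C^2$ with Kraus operators $C_i\otimes|0\rangle\langle 0|+\theta(C_i)\otimes|1\rangle\langle 1|$. A bipartite channel is no-signalling if it is of the form $\sum_j c_j\,\mathcal A_j\otimes\mathcal B_j$ with $c_j\in\mathbb R$ and channels $\mathcal A_j,\mathcal B_j$. A two-slot supermap (possibly with indefinite causal order) is a linear map $\mathcal S$ from linear maps $L(H_{A_i}\otimes H_{B_i})\to L(H_{A_o}\otimes H_{B_o})$ to linear maps $L(H_{C_i})\to L(H_{C_o})$ that sends no-signalling channels to channels and such that $(\mathcal S\otimes\mathcal I_{D_iD_o})(\mathcal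 M)$ is a channel for all finite-dimensional systems $D_i,D_o$ and every channel $\mathcal M$ from $A_iB_iD_i$ to $A_oB_oD_o$ for which $\rho\mapsto \mathrm{Tr}_{D_o}[\mathcal M(\rho\otimes\sigma)]$ is no-signalling for every state $\sigma$ of $D_i$. Here $H_{A_i},H_{A_o},H_{B_i},H_{B_o}$ are all $\mathbb C^d$. Used forward, $\mathcal S$ gives $\mathcal S_{\rm fwd}(\mathcal A,\mathcal B)=\mathcal S(\mathcal A\otimes\mathcal B)$; used backward, it gives $\mathcal S_{\rm bwd}(\mathcal A,\mathcal B)=\mathcal S(\Theta(\mathcal A)\otimes\Theta(\mathcal B))$. Theorem. (1) There are no $p\in[0,1]$, forward $\mathcal S_{\rm fwd}$ and backward $\mathcal S_{\rm bwd}$, arising from two such supermaps with output maps on $\mathbb C^d\otimes\mathbb C^2$, such that $$\mathcal F(\mathcal U)=p\,\mathcal S_{\rm fwd}(\mathcal U,\mathcal U)+(1-p)\,\mathcal S_{\rm bwd}(\mathcal U,\mathcal U)\quad\text{for all } U\in U(d).$$ (2) For every such supermap $\mathcal S$ with output maps on $\mathbb C^d$, let $D_U$ be the Choi operator of $\mathcal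 S(\mathcal U\otimes\mathcal U)$ and let $E_U$ be the Choi operator of the unitary channel $\rho\mapsto U^T\rho\,\overline U$, where the Choi operator of $\mathcal M$ is $\sum_{m,n}\mathcal M(|m\rangle\langle n|)\otimes|m\rangle\langle n|$. Then the average fidelity $F=\int \mathrm{Tr}[D_UE_U]/d^2\,dU$ over the normalized Haar measure of $U(d)$ satisfies $F\le 6/d^2$ if $d>2$ and $F\le 5/6$ if $d=2$. -/

import Mathlib

open scoped Kronecker ComplexOrder
open MeasureTheory

namespace TimeFlip

/-- Linear maps from the operators on `ℂ^a` to the operators on `ℂ^b`. -/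
abbrev OpMap (a b : Type) := Matrix a a ℂ →ₗ[ℂ] Matrix b b ℂ

section Channels

variable {a b c e : Type} [Fintype a] [DecidableEq a] [Fintype b] [DecidableEq b]
  [Fintype c] [DecidableEq c] [Fintype e] [DecidableEq e]

/-- The map `ρ ↦ A ρ B†`. -/
def sandwich (A B : Matrix b a ℂ) : OpMap a b where
  toFun X := A * X * B.conjTranspose
  map_add' X Y := by rw [Matrix.mul_add, Matrix.add_mul]
  map_smul' r X := by simp

theorem sandwich_apply (A B : Matrix b a ℂ) (X : Matrix a a ℂ) :
    sandwich A B X = A * X * B.conjTranspose := rfl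

/-- The map `ρ ↦ K ρ K†`. For a unitary `K` this is the unitary channel of `K`. -/
def conjBy (K : Matrix b a ℂ) : OpMap a b := sandwich K K

/-- The map `ρ ↦ ∑ i, K i ρ (K i)†` with Kraus operators `K`. -/
def krausMap {ι : Type} [Fintype ι] (K : ι → Matrix b a ℂ) : OpMap a b :=
  ∑ i, conjBy (K i)

/-- The block `X_{mn}` of an operator `X = ∑ m n, X_{mn} ⊗ |m⟩⟨n|` on `ℂ^a ⊗ ℂ^c`. -/
def block (m n : c) : Matrix (a × c) (a × c) ℂ →ₗ[ℂ] Matrix a a ℂ where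
  toFun X := Matrix.of fun i j => X (i, m) (j, n)
  map_add' _ _ := rfl
  map_smul' _ _ := rfl

theorem block_apply (m n : c) (X : Matrix (a × c) (a × c) ℂ) (i j : a) :
    block m n X i j = X (i, m) (j, n) := rfl

/-- The tensor product `Φ ⊗ Ψ`, which maps `∑ m n, X_{mn} ⊗ |m⟩⟨n|` to
`∑ m n, Φ(X_{mn}) ⊗ Ψ(|m⟩⟨n|)`; see `tensorMap_kronecker`. -/
def tensorMap (Φ : OpMap a b) (Ψ : OpMap c e) : OpMap (a × c) (b × e) where
  toFun X := Matrix.of fun p q => ∑ m, ∑ n,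
    Φ (block m n X) p.1 q.1 *
      Ψ (Matrix.single m n 1) p.2 q.2
  map_add' X Y := by
    ext p q
    simp [add_mul, Finset.sum_add_distrib]
  map_smul' r X := by
    ext p q
    simp [Finset.mul_sum, mul_assoc]

theorem tensorMap_apply (Φ : OpMap a b) (Ψ : OpMap c e) (X : Matrix (a × c) (a × c) ℂ)
    (p q : b × e) : tensorMap Φ Ψ X p q =
      ∑ m, ∑ n, Φ (block m n X) p.1 q.1 * Ψ (Matrix.single m n 1) p.2 q.2 := rfl

theorem tensorMap_kronecker (Φ : OpMap a b) (Ψ : OpMap c e) (X : Matrix a a ℂ)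
    (Y : Matrix c c ℂ) : tensorMap Φ Ψ (X ⊗ₖ Y) = Φ X ⊗ₖ Ψ Y := by
  have h : ∀ m n, block m n (X ⊗ₖ Y) = Y m n • X := by
    intro m n
    ext i j
    simp [block_apply, mul_comm]
  ext p q
  have hY : Ψ Y = ∑ m, ∑ n, Y m n • Ψ (Matrix.single m n 1) := by
    conv_lhs => rw [Matrix.matrix_eq_sum_single Y]
    simp only [map_sum]
    refine Finset.sum_congr rfl fun m _ => Finset.sum_congr rfl fun n _ => ?_
    rw [← map_smul, Matrix.smul_single, smul_eq_mul, mul_one]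
  rw [hY]
  simp only [tensorMap_apply, h, map_smul,
    Matrix.smul_apply, smul_eq_mul, Matrix.kroneckerMap_apply, Matrix.sum_apply, Finset.mul_sum]
  refine Finset.sum_congr rfl fun m _ => Finset.sum_congr rfl fun n _ => ?_
  ring

/-- Complete positivity: `Φ ⊗ id_k` maps positive operators to positive operators, for all `k`. -/
def IsCP (Φ : OpMap a b) : Prop :=
  ∀ (k : ℕ) (X : Matrix (a × Fin k) (a × Fin k) ℂ), X.PosSemidef →
    (tensorMap Φ (LinearMap.id : OpMap (Fin k) (Fin k)) X).PosSemidef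

/-- Quantum channels: completely positive trace-preserving maps. -/
def IsChannel (Φ : OpMap a b) : Prop :=
  IsCP Φ ∧ ∀ X, (Φ X).trace = X.trace

/-- Density matrices. -/
def IsDensity (σ : Matrix a a ℂ) : Prop :=
  σ.PosSemidef ∧ σ.trace = 1

/-- The Choi operator `∑ m n, Φ(|m⟩⟨n|) ⊗ |m⟩⟨n|`. -/
def choi (Φ : OpMap a b) : Matrix (b × a) (b × a) ℂ :=
  Matrix.of fun p q => Φ (Matrix.single p.2 q.2 1) p.1 q.1

/-- The reduced map `ρ ↦ Tr_e [M (ρ ⊗ σ)]`. -/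
def reduced (M : OpMap (a × c) (b × e)) (σ : Matrix c c ℂ) : OpMap a b where
  toFun ρ := Matrix.of fun i j => ∑ k, M (ρ ⊗ₖ σ) (i, k) (j, k)
  map_add' X Y := by
    ext i j
    simp [Matrix.add_kronecker, Finset.sum_add_distrib]
  map_smul' r X := by
    ext i j
    simp [Matrix.smul_kronecker, Finset.mul_sum]

end Channels

section Supermaps

variable {Ai Ao Bi Bo Ci Co Di Do : Type}
  [Fintype Ai] [DecidableEq Ai] [Fintype Ao] [DecidableEq Ao]
  [Fintype Bi] [DecidableEq Bi] [Fintype Bo] [DecidableEq Bo]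
  [Fintype Ci] [DecidableEq Ci] [Fintype Co] [DecidableEq Co]
  [Fintype Di] [DecidableEq Di] [Fintype Do] [DecidableEq Do]

/-- No-signalling channels for the bipartition `Ai → Ao | Bi → Bo`: the channels that are
real linear combinations of products of channels. -/
def IsNoSignalling (N : OpMap (Ai × Bi) (Ao × Bo)) : Prop :=
  IsChannel N ∧ ∃ (r : ℕ) (t : Fin r → ℝ) (A : Fin r → OpMap Ai Ao) (B : Fin r → OpMap Bi Bo),
    (∀ j, IsChannel (A j)) ∧ (∀ j, IsChannel (B j)) ∧
      N = ∑ j, (t j : ℂ) • tensorMap (A j) (B j)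

/-- The component of `M` that takes an operator `X` to the `(k', l')` block of
`M (X ⊗ |k⟩⟨l|)`. -/
def component (M : OpMap (Ai × Di) (Ao × Do)) (k l : Di) (k' l' : Do) : OpMap Ai Ao where
  toFun X := block k' l' (M (X ⊗ₖ Matrix.single k l 1))
  map_add' X Y := by simp [Matrix.add_kronecker]
  map_smul' r X := by simp [Matrix.smul_kronecker]

/-- The local action `(S ⊗ I_{Di Do}) (M)` of a linear map `S` between spaces of maps. It is
linear in `M`, and on products it is given by `localAction_tensorMap`. -/
def localAction (S : OpMap Ai Ao →ₗ[ℂ] OpMap Ci Co) (M : OpMap (Ai × Di) (Ao × Do)) :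
    OpMap (Ci × Di) (Co × Do) where
  toFun Y := Matrix.of fun p q => ∑ k, ∑ l,
    S (component M k l p.2 q.2) (block k l Y) p.1 q.1
  map_add' X Y := by
    ext p q
    simp [Finset.sum_add_distrib]
  map_smul' r X := by
    ext p q
    simp [Finset.mul_sum]

theorem localAction_apply (S : OpMap Ai Ao →ₗ[ℂ] OpMap Ci Co) (M : OpMap (Ai × Di) (Ao × Do))
    (Y : Matrix (Ci × Di) (Ci × Di) ℂ) (p q : Co × Do) : localAction S M Y p q =
      ∑ k, ∑ l, S (component M k l p.2 q.2) (block k l Y) p.1 q.1 := rfl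

theorem localAction_tensorMap (S : OpMap Ai Ao →ₗ[ℂ] OpMap Ci Co) (Φ : OpMap Ai Ao)
    (Ψ : OpMap Di Do) : localAction S (tensorMap Φ Ψ) = tensorMap (S Φ) Ψ := by
  have h : ∀ k l k' l', component (tensorMap Φ Ψ) k l k' l' =
      Ψ (Matrix.single k l 1) k' l' • Φ := by
    intro k l k' l'
    refine LinearMap.ext fun X => ?_
    ext i j
    change block k' l' (tensorMap Φ Ψ (X ⊗ₖ Matrix.single k l 1)) i j = _
    rw [tensorMap_kronecker, block_apply, LinearMap.smul_apply, Matrix.smul_apply, smul_eq_mul,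
      Matrix.kroneckerMap_apply, mul_comm]
  refine LinearMap.ext fun Y => ?_
  ext p q
  simp only [localAction_apply, tensorMap_apply, h, map_smul, LinearMap.smul_apply,
    Matrix.smul_apply, smul_eq_mul, mul_comm]

/-- Two-slot quantum supermaps, possibly with indefinite causal order: linear maps that send
no-signalling channels to channels, also when they act locally on an extension. -/
def IsSupermap (S : OpMap (Ai × Bi) (Ao × Bo) →ₗ[ℂ] OpMap Ci Co) : Prop :=
  (∀ N, IsNoSignalling N → IsChannel (S N)) ∧
  ∀ (m n : ℕ) (M : OpMap ((Ai × Bi) × Fin m) ((Ao × Bo) × Fin n)), IsChannel M →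
    (∀ σ, IsDensity σ → IsNoSignalling (reduced M σ)) → IsChannel (localAction S M)

end Supermaps

section Inversion

variable {a b a' b' : Type} [Fintype a] [DecidableEq a] [Fintype b] [DecidableEq b]
  [Fintype a'] [DecidableEq a'] [Fintype b'] [DecidableEq b']

/-- The transformation of maps induced by a linear transformation `G` of Kraus operators: if
`M` has Kraus operators `K i`, then the result has Kraus operators `G (K i)`; see
`liftKraus_krausMap`. Here `M = ∑ M(|m⟩⟨n|)_{ij} |i⟩⟨m| · (|j⟩⟨n|)†`. -/
def liftKraus (G : Matrix b a ℂ →ₗ[ℂ] Matrix b' a' ℂ) : OpMap a b →ₗ[ℂ] OpMap a' b' where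
  toFun M := ∑ i, ∑ m, ∑ j, ∑ n, M (Matrix.single m n 1) i j •
    sandwich (G (Matrix.single i m 1)) (G (Matrix.single j n 1))
  map_add' M N := by
    simp only [LinearMap.add_apply, Matrix.add_apply, add_smul, Finset.sum_add_distrib]
  map_smul' r M := by
    simp only [LinearMap.smul_apply, Matrix.smul_apply, smul_eq_mul, mul_smul, Finset.smul_sum,
      RingHom.id_apply]

theorem liftKraus_apply (G : Matrix b a ℂ →ₗ[ℂ] Matrix b' a' ℂ) (M : OpMap a b) :
    liftKraus G M = ∑ i, ∑ m, ∑ j, ∑ n, M (Matrix.single m n 1) i j •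
      sandwich (G (Matrix.single i m 1)) (G (Matrix.single j n 1)) := rfl

theorem liftKraus_conjBy (G : Matrix b a ℂ →ₗ[ℂ] Matrix b' a' ℂ) (K : Matrix b a ℂ) :
    liftKraus G (conjBy K) = conjBy (G K) := by
  have hK : G K = ∑ i, ∑ m, K i m • G (Matrix.single i m 1) := by
    conv_lhs => rw [Matrix.matrix_eq_sum_single K]
    simp only [map_sum]
    refine Finset.sum_congr rfl fun m _ => Finset.sum_congr rfl fun n _ => ?_
    rw [← map_smul, Matrix.smul_single, smul_eq_mul, mul_one]
  have hK' : (G K).conjTranspose =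
      ∑ j, ∑ n, star (K j n) • (G (Matrix.single j n 1)).conjTranspose := by
    simp only [hK, Matrix.conjTranspose_sum, Matrix.conjTranspose_smul]
  have h : ∀ m n i j, conjBy K (Matrix.single m n 1) i j = star (K j n) * K i m := by
    intro m n i j
    simp [conjBy, sandwich_apply, Matrix.mul_apply, Matrix.single_apply, ite_and, mul_comm]
  refine LinearMap.ext fun X => ?_
  simp only [conjBy, sandwich_apply, liftKraus_apply, LinearMap.sum_apply,
    LinearMap.smul_apply, hK'] at h ⊢
  rw [hK]
  simp only [h, Matrix.sum_mul, Matrix.mul_sum, Matrix.smul_mul, Matrix.mul_smul,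
    Finset.smul_sum, smul_smul]
  calc _ = _ := Finset.sum_congr rfl fun i _ => Finset.sum_comm
    _ = _ := Finset.sum_comm
    _ = _ := Finset.sum_congr rfl fun j _ =>
      (Finset.sum_congr rfl fun i _ => Finset.sum_comm).trans Finset.sum_comm

theorem liftKraus_krausMap {ι : Type} [Fintype ι] (G : Matrix b a ℂ →ₗ[ℂ] Matrix b' a' ℂ)
    (K : ι → Matrix b a ℂ) : liftKraus G (krausMap K) = krausMap fun i => G (K i) := by
  simp only [krausMap, map_sum, liftKraus_conjBy]

variable {d : ℕ}

/-- The transformation `θ (C) = W Cᵀ W†` of Kraus operators, unitarily equivalent to the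
transpose. -/
def theta (W : Matrix a a ℂ) : Matrix a a ℂ →ₗ[ℂ] Matrix a a ℂ where
  toFun C := W * C.transpose * W.conjTranspose
  map_add' X Y := by simp [Matrix.mul_add, Matrix.add_mul]
  map_smul' r X := by simp

/-- The input-output inversion `Θ` of maps, with Kraus operators `θ (C_i)`. -/
def inversion (W : Matrix a a ℂ) : OpMap a a →ₗ[ℂ] OpMap a a :=
  liftKraus (theta W)

/-- The controlled Kraus operator `C ⊗ |0⟩⟨0| + θ (C) ⊗ |1⟩⟨1|`. -/
def flipOp (W : Matrix a a ℂ) :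
    Matrix a a ℂ →ₗ[ℂ] Matrix (a × Fin 2) (a × Fin 2) ℂ where
  toFun C := C ⊗ₖ Matrix.single 0 0 1 + theta W C ⊗ₖ Matrix.single 1 1 1
  map_add' X Y := by
    simp only [map_add, Matrix.add_kronecker]
    abel
  map_smul' r X := by
    simp only [map_smul, Matrix.smul_kronecker, RingHom.id_apply, smul_add]

/-- The quantum time flip, with Kraus operators `C_i ⊗ |0⟩⟨0| + θ (C_i) ⊗ |1⟩⟨1|`. -/
def timeFlip (W : Matrix a a ℂ) : OpMap a a →ₗ[ℂ] OpMap (a × Fin 2) (a × Fin 2) :=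
  liftKraus (flipOp W)

variable {Ci Co : Type} [Fintype Ci] [DecidableEq Ci] [Fintype Co] [DecidableEq Co]

/-- Use of a pair of maps in the forward direction. -/
def forward (S : OpMap (a × a) (a × a) →ₗ[ℂ] OpMap Ci Co) (A B : OpMap a a) : OpMap Ci Co :=
  S (tensorMap A B)

/-- Use of a pair of maps in the backward direction. -/
def backward (W : Matrix a a ℂ) (S : OpMap (a × a) (a × a) →ₗ[ℂ] OpMap Ci Co)
    (A B : OpMap a a) : OpMap Ci Co :=
  S (tensorMap (inversion W A) (inversion W B))

/-- The Choi fidelity `Tr [D_U E_U] / d ^ 2`, where `D_U` is the Choi operator of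
`S (U ⊗ U)` and `E_U` is the Choi operator of the unitary channel of `Uᵀ`. -/
noncomputable def transposeFidelity
    (S : OpMap (Fin d × Fin d) (Fin d × Fin d) →ₗ[ℂ] OpMap (Fin d) (Fin d))
    (U : Matrix (Fin d) (Fin d) ℂ) : ℝ :=
  ((choi (forward S (conjBy U) (conjBy U)) * choi (conjBy U.transpose)).trace).re / (d : ℝ) ^ 2

end Inversion

end TimeFlip

/-!
A supermap `S` has a positive semidefinite operator `superChoi S`, and no-signalling fixes its trace
against the operators `N ⊗ 1` with `N` the Choi operator of a family of no-signalling maps (these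
are the feasible points of a dual semidefinite programme). The average fidelity is, up to a factor
`1 / d ^ 2`, the trace of `superChoi S` against the Choi operator of the twirl by `Ū ⊗ Ū ⊗ U`.
Hence every dual feasible operator that dominates the latter after scaling bounds the average
fidelity.

By Schur–Weyl duality and a partial transpose, the twirl takes values in the span of the projections
on the symmetric and antisymmetric traceless tensors and of the matrix units of the remaining
`ℂ^d ⊗ ℂ²`. Adding the conjugate of the twirl by a reflection of the factor `ℂ²`, which is
completely positive, removes the off-diagonal matrix units and leaves a sum of measure-and-prepare
maps. For `d > 2` it suffices to replace the second tensor factor of each term of its Choi operator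
by the identity; for `d = 2` the antisymmetric traceless part vanishes and there is a better choice.

Both bounds are less than one. If the time flip were a convex combination of forward and backward
uses of supermaps, then fixing the control qubit would produce a supermap that turns two uses of
every unitary `U` into `Uᵀ`, because unitary channels are extremal: a contradiction.
-/

namespace TimeFlip

open Matrix

section UnitaryDensity

variable {a : Type*} {f : MvPolynomial (a × a) ℂ}

theorem infinite_unitary_complex : (unitary ℂ : Set ℂ).Infinite := by
  have : Infinite (Set.Ioc (-Real.pi) Real.pi) :=
    (Set.Ioc_infinite (neg_lt_self Real.pi_pos)).to_subtype
  have : Infinite Circle := Circle.argEquiv.infinite_iff.mpr this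
  refine (Set.infinite_range_of_injective (α := Circle) Circle.coe_injective).mono ?_
  rintro _ ⟨z, rfl⟩
  rw [SetLike.mem_coe, Unitary.mem_iff_self_mul_star, RCLike.star_def, ← Circle.coe_inv_eq_conj,
    ← Circle.coe_mul, mul_inv_cancel, Circle.coe_one]

theorem eval_add_smul_eq_zero {B C : Matrix a a ℂ}
    (hf : ∀ t : ℝ, f.eval (fun p => (B + t • C) p.1 p.2) = 0) (z : ℂ) :
    f.eval (fun p => (B + z • C) p.1 p.2) = 0 := by
  let x : a × a → Polynomial ℂ := fun p =>
    Polynomial.C (B p.1 p.2) + Polynomial.X * Polynomial.C (C p.1 p.2)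
  let g : Polynomial ℂ := f.eval₂ Polynomial.C x
  have hg : ∀ z, g.eval z = f.eval (fun p => (B + z • C) p.1 p.2) := fun z => by
    rw [MvPolynomial.polynomial_eval_eval₂, MvPolynomial.eval, MvPolynomial.coe_eval₂Hom]
    congr 1
    · ext
      simp
    · ext p
      simp [x, mul_comm z]
  have hg0 : g = 0 := Polynomial.eq_of_infinite_eval_eq _ _ <|
    (Set.infinite_range_of_injective Complex.ofReal_injective).mono <| by
      rintro _ ⟨t, rfl⟩
      exact (hg _).trans ((hf t).trans Polynomial.eval_zero.symm)
  rw [← hg, hg0, Polynomial.eval_zero]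

variable [Fintype a] [DecidableEq a]

open MvPolynomial in
theorem eval_mul_diagonal_mul_eq_zero {U V : Matrix a a ℂ}
    (hf : ∀ z : a → ℂ, (∀ i, z i ∈ unitary ℂ) →
      eval (fun p => (U * diagonal z * V) p.1 p.2) f = 0) (z : a → ℂ) :
    eval (fun p => (U * diagonal z * V) p.1 p.2) f = 0 := by
  let g : MvPolynomial a ℂ := bind₁ (fun p => ∑ k, C (U p.1 k * V k p.2) * X k) f
  have hg : ∀ z, eval z g = eval (fun p => (U * diagonal z * V) p.1 p.2) f := fun z => by
    simp only [g, eval, eval₂Hom_bind₁]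
    congr! 2 with p
    rw [funext_iff]
    simp [Matrix.mul_apply (M := U * _), Matrix.mul_diagonal, mul_right_comm]
  have hg0 : g = 0 :=
    funext_set (fun _ => (unitary ℂ : Set ℂ)) (fun _ => infinite_unitary_complex) fun z hz => by
      rw [hg, map_zero, hf z fun i => hz i trivial]
  rw [← hg, hg0, map_zero]

theorem mvPolynomial_eq_zero_of_eval_unitaryGroup
    (hf : ∀ U ∈ unitaryGroup a ℂ, f.eval (fun p => U p.1 p.2) = 0) : f = 0 := by
  have hherm : ∀ H : Matrix a a ℂ, H.IsHermitian → f.eval (fun p => H p.1 p.2) = 0 := by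
    intro H hH
    rw [hH.spectral_theorem, Unitary.conjStarAlgAut_apply]
    refine eval_mul_diagonal_mul_eq_zero (fun z hz => hf _ ?_) _
    refine mul_mem (mul_mem (SetLike.coe_mem _) ?_) (Unitary.star_mem (SetLike.coe_mem _))
    rw [mem_unitaryGroup_iff, star_eq_conjTranspose, diagonal_conjTranspose, diagonal_mul_diagonal,
      ← diagonal_one]
    exact congrArg diagonal (funext fun i => Unitary.mul_star_self_of_mem (hz i))
  refine MvPolynomial.funext fun x => ?_
  let A : Matrix a a ℂ := Matrix.of fun i j => x (i, j)
  have hx := eval_add_smul_eq_zero (f := f)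
    (fun t => hherm _ (realPart A + t • imaginaryPart A).2) Complex.I
  rw [realPart_add_I_smul_imaginaryPart] at hx
  rw [map_zero]
  exact hx

end UnitaryDensity

section DoubleCentralizer

variable {G n K : Type*} [Group G] [Fintype G] [Fintype n] [DecidableEq n] [Field K]

/-- The action of `P` from column `c'` to column `c`. -/
def columnBlock (P : Matrix n n K →ₗ[K] Matrix n n K) (c c' : n) : Matrix n n K :=
  Matrix.of fun i j => P (single j c' 1) i c

theorem forall_map_mul_iff_forall_commute_columnBlock (P : Matrix n n K →ₗ[K] Matrix n n K)
    (A : Matrix n n K) :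
    (∀ Y, P (A * Y) = A * P Y) ↔ ∀ c c', Commute A (columnBlock P c c') := by
  have key : ∀ i j c c', P (A * single j c' 1) i c = (columnBlock P c c' * A) i j := by
    intro i j c c'
    have : A * single j c' 1 = ∑ k, A k j • single k c' 1 := by
      ext k l
      simp [Matrix.mul_apply, Matrix.sum_apply, single_apply, ite_and]
    simp only [this, map_sum, map_smul, Matrix.sum_apply, Matrix.smul_apply, smul_eq_mul,
      columnBlock, Matrix.mul_apply, Matrix.of_apply, mul_comm]
  constructor
  · intro h c c'
    ext i j
    rw [← key, h]
    rfl
  · intro h Y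
    refine LinearMap.congr_fun (f := P ∘ₗ LinearMap.mulLeft K A) (g := LinearMap.mulLeft K A ∘ₗ P)
      (Matrix.ext_linearMap K fun j c' => LinearMap.ext_ring ?_) Y
    ext i c
    exact (key i j c c').trans (congrFun (congrFun (h c c').eq i) j).symm

/-- The average of `P` over the left multiplications by a finite matrix group. -/
def leftAverage (ρ : G →* Matrix n n K) (P : Matrix n n K →ₗ[K] Matrix n n K) :
    Matrix n n K →ₗ[K] Matrix n n K :=
  (Fintype.card G : K)⁻¹ •
    ∑ g, LinearMap.mulLeft K (ρ g⁻¹) ∘ₗ P ∘ₗ LinearMap.mulLeft K (ρ g)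

theorem leftAverage_apply (ρ : G →* Matrix n n K) (P : Matrix n n K →ₗ[K] Matrix n n K)
    (Y : Matrix n n K) :
    leftAverage ρ P Y = (Fintype.card G : K)⁻¹ • ∑ g, ρ g⁻¹ * P (ρ g * Y) := by
  simp [leftAverage]

theorem leftAverage_mul (ρ : G →* Matrix n n K) (P : Matrix n n K →ₗ[K] Matrix n n K) (h : G)
    (Y : Matrix n n K) : leftAverage ρ P (ρ h * Y) = ρ h * leftAverage ρ P Y := by
  rw [leftAverage_apply, leftAverage_apply, mul_smul_comm, Finset.mul_sum]
  congr 1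
  refine Fintype.sum_equiv (Equiv.mulRight h) _ _ fun g => ?_
  simp only [Equiv.coe_mulRight, ← mul_assoc, ← map_mul, _root_.mul_inv_rev, mul_inv_cancel,
    one_mul]

theorem mem_span_range_of_forall_commute (hG : (Fintype.card G : K) ≠ 0) (ρ : G →* Matrix n n K)
    {X : Matrix n n K} (hX : ∀ Y, (∀ g, Commute (ρ g) Y) → Commute X Y) :
    X ∈ Submodule.span K (Set.range ρ) := by
  set S := Submodule.span K (Set.range ρ)
  have hρS : ∀ g, ρ g ∈ S := fun g => Submodule.subset_span ⟨g, rfl⟩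
  obtain ⟨π, hπ⟩ := S.subtype.exists_leftInverse_of_injective S.ker_subtype
  let P := leftAverage ρ (S.subtype ∘ₗ π)
  have hone : P 1 = 1 := by
    have hπρ : ∀ g, (π (ρ g) : Matrix n n K) = ρ g := fun g =>
      congrArg Subtype.val (LinearMap.congr_fun hπ ⟨ρ g, hρS g⟩)
    simp [P, leftAverage_apply, hπρ, ← map_mul, ← Nat.cast_smul_eq_nsmul K, hG]
  have hmem : P X ∈ S := by
    have hmul : ∀ g, S ≤ S.comap (LinearMap.mulLeft K (ρ g)) := fun g => by
      rw [Submodule.span_le]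
      rintro _ ⟨h, rfl⟩
      exact (congrArg (· ∈ S) (map_mul ρ g h)).mp (hρS (g * h))
    rw [leftAverage_apply]
    exact S.smul_mem _ (S.sum_mem fun g _ => hmul _ (π _).2)
  have hPX : P (X * 1) = X * P 1 := by
    refine (forall_map_mul_iff_forall_commute_columnBlock P X).mpr (fun c c' => hX _ fun g => ?_) 1
    exact (forall_map_mul_iff_forall_commute_columnBlock P (ρ g)).mp (leftAverage_mul ρ _ g) c c'
  rw [hone, mul_one] at hPX
  exact hPX ▸ hmem

end DoubleCentralizer

section TensorPower

variable {ι a : Type*} [Fintype ι]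

theorem exists_perm_of_sum_single_eq {β : Type*} {f g : ι → β}
    (h : ∑ i, Finsupp.single (f i) 1 = ∑ i, Finsupp.single (g i) 1) :
    ∃ σ : Equiv.Perm ι, g ∘ σ = f := by
  classical
  have hcard : ∀ b, Nonempty ({i // f i = b} ≃ {i // g i = b}) := fun b => by
    refine Fintype.card_eq.mp ?_
    simpa [Finsupp.finsetSum_apply, Finsupp.single_apply, Fintype.card_subtype] using
      DFunLike.congr_fun h b
  exact ⟨Equiv.ofFiberEquiv fun b => (hcard b).some,
    funext (Equiv.ofFiberEquiv_map fun b => (hcard b).some)⟩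

/-- The tensor power `U ⊗ ⋯ ⊗ U` with factors indexed by `ι`. -/
def tensorPower {R : Type*} [CommMonoid R] (ι : Type*) [Fintype ι] (U : Matrix a a R) :
    Matrix (ι → a) (ι → a) R :=
  Matrix.of fun p q => ∏ i, U (p i) (q i)

section PermAction

variable [DecidableEq ι] [Fintype a] [DecidableEq a] (R : Type*) [Semiring R]

/-- The permutation of the tensor factors by `σ`, as a representation of the symmetric group. -/
def tensorPerm : Equiv.Perm ι →* Matrix (ι → a) (ι → a) R where
  toFun σ := Matrix.of fun p q => if p ∘ σ = q then 1 else 0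
  map_one' := by
    ext p q
    simp [Matrix.one_apply]
  map_mul' σ τ := by
    ext p q
    simp only [Matrix.mul_apply, Matrix.of_apply, ite_mul, one_mul, zero_mul, Finset.sum_ite_eq,
      Finset.mem_univ, if_true]
    rfl

variable {R} in
theorem apply_comp_of_commute_tensorPerm {Y : Matrix (ι → a) (ι → a) R} {σ : Equiv.Perm ι}
    (hY : Commute (tensorPerm R σ) Y) (p q : ι → a) : Y (p ∘ σ) (q ∘ σ) = Y p q := by
  have h := congrFun (congrFun hY.eq p) (q ∘ σ)
  have hinj : ∀ r : ι → a, r ∘ σ = q ∘ σ ↔ r = q := fun r =>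
    σ.surjective.injective_comp_right.eq_iff
  simpa [tensorPerm, Matrix.mul_apply, hinj] using h

end PermAction

theorem tensorPower_mvPolynomialX_apply (p q : ι → a) :
    tensorPower ι (mvPolynomialX a a ℂ) p q =
      MvPolynomial.monomial (∑ i, Finsupp.single (p i, q i) 1) 1 := by
  simp [tensorPower, MvPolynomial.monomial_sum_one, MvPolynomial.X]

variable [DecidableEq ι] [Fintype a] [DecidableEq a]

open MvPolynomial in
theorem commute_map_C_tensorPower_mvPolynomialX {X : Matrix (ι → a) (ι → a) ℂ}
    (hX : ∀ U ∈ unitaryGroup a ℂ, Commute X (tensorPower ι U)) :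
    Commute (X.map C) (tensorPower ι (mvPolynomialX a a ℂ)) := by
  refine Matrix.ext fun p q => ?_
  rw [← sub_eq_zero]
  refine mvPolynomial_eq_zero_of_eval_unitaryGroup fun U hU => ?_
  simpa [Matrix.mul_apply, tensorPower, sub_eq_zero] using congrFun (congrFun (hX U hU).eq p) q

open MvPolynomial in
theorem commute_of_commute_tensorPower {X Y : Matrix (ι → a) (ι → a) ℂ}
    (hX : ∀ U ∈ unitaryGroup a ℂ, Commute X (tensorPower ι U))
    (hY : ∀ σ, Commute (tensorPerm ℂ σ) Y) : Commute X Y := by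
  let e : (ι → a) × (ι → a) → a × a →₀ ℕ := fun x => ∑ i, Finsupp.single (x.1 i, x.2 i) 1
  have hYe : (fun x : (ι → a) × (ι → a) => Y x.1 x.2).FactorsThrough e := by
    rintro ⟨p, q⟩ ⟨p', q'⟩ h
    obtain ⟨σ, hσ⟩ := exists_perm_of_sum_single_eq h
    obtain rfl : p' ∘ σ = p := funext fun i => congrArg Prod.fst (congrFun hσ i)
    obtain rfl : q' ∘ σ = q := funext fun i => congrArg Prod.snd (congrFun hσ i)
    exact apply_comp_of_commute_tensorPerm (hY σ) p' q'
  let φ : MvPolynomial (a × a) ℂ →ₗ[ℂ] ℂ :=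
    (basisMonomials (a × a) ℂ).constr ℂ (Function.extend e (fun x => Y x.1 x.2) 0)
  have hφ : ∀ p q, φ (tensorPower ι (mvPolynomialX a a ℂ) p q) = Y p q := fun p q => by
    rw [tensorPower_mvPolynomialX_apply]
    exact ((basisMonomials _ _).constr_basis ℂ _ _).trans (hYe.extend_apply 0 (p, q))
  ext p q
  have h := congrArg φ (congrFun (congrFun (commute_map_C_tensorPower_mvPolynomialX hX).eq p) q)
  simpa [Matrix.mul_apply, C_mul', mul_comm _ (C _), hφ, mul_comm (X _ _)] using h

/-- Schur–Weyl duality for the unitary group. -/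
theorem mem_span_range_tensorPerm {X : Matrix (ι → a) (ι → a) ℂ}
    (hX : ∀ U ∈ unitaryGroup a ℂ, Commute X (tensorPower ι U)) :
    X ∈ Submodule.span ℂ (Set.range (tensorPerm ℂ)) :=
  mem_span_range_of_forall_commute (Nat.cast_ne_zero.mpr Fintype.card_ne_zero) _
    fun _ hY => commute_of_commute_tensorPower hX hY

end TensorPower

open scoped MatrixOrder in
theorem posSemidef_of_isStarProjection {n : Type*} [Fintype n] {P : Matrix n n ℂ}
    (hP : IsStarProjection P) : P.PosSemidef := by
  classical
  exact nonneg_iff_posSemidef.mp hP.nonneg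

section TripleAlgebra

variable (a : Type*)

theorem card_add_sign_ne_zero [Fintype a] [Nontrivial a] (ε : ℤˣ) :
    (Fintype.card a + ((ε : ℤ) : ℂ)) ≠ 0 := by
  have h : 1 < Fintype.card a := Fintype.one_lt_card
  rcases Int.units_eq_one_or ε with rfl | rfl
  · simpa using Nat.cast_add_one_ne_zero (R := ℂ) (Fintype.card a)
  · simpa [← sub_eq_add_neg, sub_eq_zero] using h.ne'

variable [DecidableEq a]

/-- The exchange of the two tensor factors of `ℂ^a ⊗ ℂ^a`. -/
def swapOp : Matrix (a × a) (a × a) ℂ :=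
  (1 : Matrix (a × a) (a × a) ℂ).submatrix Prod.swap id

/-- The exchange of the first two of three copies of `ℂ^a`. -/
def swap₁₂ : Matrix ((a × a) × a) ((a × a) × a) ℂ :=
  swapOp a ⊗ₖ 1

/-- The embedding `v ↦ ∑ m, |m⟩ ⊗ v ⊗ |m⟩` of `ℂ^a` into three copies of itself. -/
def pairEmb : Matrix ((a × a) × a) a ℂ :=
  Matrix.of fun p m => if p.1.1 = p.2 ∧ p.1.2 = m then 1 else 0

/-- The projection on the tensors that are symmetric (`ε = 1`) or antisymmetric (`ε = -1`) in the
first two of three copies of `ℂ^a`. -/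
noncomputable def symProj (ε : ℤˣ) : Matrix ((a × a) × a) ((a × a) × a) ℂ :=
  (2 : ℂ)⁻¹ • (1 + ((ε : ℤ) : ℂ) • swap₁₂ a)

@[simp]
theorem sign_mul_self (ε : ℤˣ) : ((ε : ℤ) : ℂ) * ((ε : ℤ) : ℂ) = 1 := by
  rw [← Int.cast_mul, ← Units.val_mul, Int.units_mul_self, Units.val_one, Int.cast_one]

theorem swapOp_apply (p q : a × a) :
    swapOp a p q = if p.1 = q.2 ∧ p.2 = q.1 then 1 else 0 := by
  simp [swapOp, Matrix.one_apply, Prod.ext_iff, and_comm]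

theorem transpose_swapOp : (swapOp a)ᵀ = swapOp a := by
  ext p q
  simp only [transpose_apply, swapOp_apply, and_comm, eq_comm]

theorem conjTranspose_swapOp : (swapOp a)ᴴ = swapOp a := by
  conv_rhs => rw [← transpose_swapOp]
  ext p q
  simp [swapOp_apply, apply_ite]

theorem transpose_swap₁₂ : (swap₁₂ a)ᵀ = swap₁₂ a := by
  rw [swap₁₂, ← kroneckerMap_transpose, transpose_swapOp, transpose_one]

theorem conjTranspose_swap₁₂ : (swap₁₂ a)ᴴ = swap₁₂ a := by
  rw [swap₁₂, conjTranspose_kronecker, conjTranspose_swapOp, conjTranspose_one]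

theorem conjTranspose_pairEmb : (pairEmb a)ᴴ = (pairEmb a)ᵀ := by
  ext p q
  simp [pairEmb, apply_ite]

theorem transpose_symProj (ε : ℤˣ) : (symProj a ε)ᵀ = symProj a ε := by
  simp [symProj, transpose_swap₁₂]

theorem conjTranspose_symProj (ε : ℤˣ) : (symProj a ε)ᴴ = symProj a ε := by
  simp [symProj, conjTranspose_smul, conjTranspose_swap₁₂]

theorem symProj_one_add_symProj_neg_one : symProj a 1 + symProj a (-1) = 1 := by
  simp only [symProj, Units.val_neg, Units.val_one, Int.cast_neg, Int.cast_one]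
  module

variable [Fintype a]

theorem swapOp_mul {n : Type*} (X : Matrix (a × a) n ℂ) :
    swapOp a * X = X.submatrix Prod.swap id := by
  ext p q
  simp [swapOp, Matrix.mul_apply, Matrix.one_apply]

theorem swapOp_mul_self : swapOp a * swapOp a = 1 := by
  rw [swapOp_mul, swapOp, submatrix_submatrix, Prod.swap_swap_eq, Function.id_comp,
    submatrix_id_id]

variable {a} in
theorem swap₁₂_mul_apply {n : Type*} (X : Matrix ((a × a) × a) n ℂ) (p : (a × a) × a) (q : n) :
    (swap₁₂ a * X) p q = X (p.1.swap, p.2) q := by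
  simp [swap₁₂, swapOp, Matrix.mul_apply, Fintype.sum_prod_type (α₁ := a × a), Matrix.one_apply]

theorem swap₁₂_mul_self : swap₁₂ a * swap₁₂ a = 1 := by
  rw [swap₁₂, ← mul_kronecker_mul, swapOp_mul_self, Matrix.one_mul, one_kronecker_one]

theorem trace_swapOp : (swapOp a).trace = Fintype.card a := by
  rw [Matrix.trace, Fintype.sum_prod_type]
  simp [swapOp_apply, ite_and]

theorem trace_swap₁₂ : (swap₁₂ a).trace = (Fintype.card a : ℂ) ^ 2 := by
  rw [swap₁₂, trace_kronecker, trace_swapOp, trace_one, sq]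

theorem transpose_pairEmb_mul_pairEmb :
    (pairEmb a)ᵀ * pairEmb a = (Fintype.card a : ℂ) • 1 := by
  ext m n
  simp only [Matrix.mul_apply, pairEmb, Fintype.sum_prod_type, ite_and, Matrix.one_apply,
    transpose_apply, of_apply, mul_ite, mul_one, mul_zero, Finset.sum_ite_eq, Finset.sum_ite_eq',
    Finset.mem_univ, if_true, Matrix.smul_apply, smul_eq_mul, eq_comm (a := m)]
  split_ifs <;> simp

theorem swap₁₂_mul_pairEmb : swap₁₂ a * pairEmb a =
    Matrix.of fun p m => if p.1.2 = p.2 ∧ p.1.1 = m then 1 else 0 := by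
  ext p m
  exact swap₁₂_mul_apply _ p m

theorem transpose_pairEmb_mul_swap₁₂_mul_pairEmb :
    (pairEmb a)ᵀ * (swap₁₂ a * pairEmb a) = 1 := by
  rw [swap₁₂_mul_pairEmb]
  ext m n
  simp [Matrix.mul_apply, pairEmb, Fintype.sum_prod_type, ite_and, Matrix.one_apply, eq_comm]

theorem swap₁₂_mul_symProj (ε : ℤˣ) : swap₁₂ a * symProj a ε = ((ε : ℤ) : ℂ) • symProj a ε := by
  simp only [symProj, mul_smul_comm, mul_add, mul_one, swap₁₂_mul_self, smul_add, smul_smul,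
    mul_left_comm _ (2⁻¹ : ℂ), sign_mul_self]
  module

theorem symProj_mul_symProj (ε δ : ℤˣ) :
    symProj a ε * symProj a δ = if ε = δ then symProj a δ else 0 := by
  conv_lhs => rw [symProj, smul_mul_assoc, add_mul, one_mul, smul_mul_assoc, swap₁₂_mul_symProj]
  rcases Int.units_eq_one_or ε with rfl | rfl <;> rcases Int.units_eq_one_or δ with rfl | rfl <;>
    simp [← two_smul ℂ]

theorem trace_symProj (ε : ℤˣ) : (symProj a ε).trace =
    (Fintype.card a : ℂ) ^ 2 * (Fintype.card a + ((ε : ℤ) : ℂ)) / 2 := by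
  simp only [symProj, trace_smul, trace_add, trace_swap₁₂, trace_one, Fintype.card_prod,
    smul_eq_mul, Nat.cast_mul]
  ring

/-- The embedding of `ℂ^a` into the (anti)symmetric part of three copies of itself. -/
noncomputable def symEmb (ε : ℤˣ) : Matrix ((a × a) × a) a ℂ :=
  symProj a ε * pairEmb a

/-- The matrix unit from the copy `symEmb a δ` of `ℂ^a` to the copy `symEmb a ε`. -/
noncomputable def symUnit (ε δ : ℤˣ) : Matrix ((a × a) × a) ((a × a) × a) ℂ :=
  symEmb a ε * (symEmb a δ)ᵀ

/-- The orthogonal projection on the range of `symEmb a ε`. -/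
noncomputable def embProj (ε : ℤˣ) : Matrix ((a × a) × a) ((a × a) × a) ℂ :=
  (2 / (Fintype.card a + ((ε : ℤ) : ℂ))) • symUnit a ε ε

/-- The orthogonal projection on the traceless (anti)symmetric tensors. -/
noncomputable def tracelessProj (ε : ℤˣ) : Matrix ((a × a) × a) ((a × a) × a) ℂ :=
  symProj a ε - embProj a ε

theorem symEmb_one_add_symEmb_neg_one : symEmb a 1 + symEmb a (-1) = pairEmb a := by
  rw [symEmb, symEmb, ← Matrix.add_mul, symProj_one_add_symProj_neg_one, Matrix.one_mul]

theorem swap₁₂_mul_symEmb (ε : ℤˣ) : swap₁₂ a * symEmb a ε = ((ε : ℤ) : ℂ) • symEmb a ε := by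
  rw [symEmb, ← Matrix.mul_assoc, swap₁₂_mul_symProj, Matrix.smul_mul]

theorem symProj_mul_symEmb (ε δ : ℤˣ) :
    symProj a ε * symEmb a δ = if ε = δ then symEmb a δ else 0 := by
  rw [symEmb, ← Matrix.mul_assoc, symProj_mul_symProj]
  split_ifs <;> simp

theorem conjTranspose_symEmb (ε : ℤˣ) : (symEmb a ε)ᴴ = (symEmb a ε)ᵀ := by
  rw [symEmb, conjTranspose_mul, transpose_mul, transpose_symProj, conjTranspose_symProj,
    conjTranspose_pairEmb]

theorem transpose_symEmb_mul_symEmb (ε δ : ℤˣ) : (symEmb a ε)ᵀ * symEmb a δ =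
    if ε = δ then ((Fintype.card a + ((δ : ℤ) : ℂ)) / 2) • 1 else 0 := by
  rw [symEmb, transpose_mul, transpose_symProj, Matrix.mul_assoc, symProj_mul_symEmb]
  split_ifs
  · rw [symEmb, symProj, Matrix.smul_mul, Matrix.mul_smul, Matrix.add_mul, Matrix.mul_add,
      Matrix.one_mul, Matrix.smul_mul, Matrix.mul_smul, transpose_pairEmb_mul_pairEmb,
      transpose_pairEmb_mul_swap₁₂_mul_pairEmb]
    module
  · rw [Matrix.mul_zero]

theorem transpose_symUnit (ε δ : ℤˣ) : (symUnit a ε δ)ᵀ = symUnit a δ ε := by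
  rw [symUnit, symUnit, transpose_mul, transpose_transpose]

theorem conjTranspose_symUnit (ε δ : ℤˣ) : (symUnit a ε δ)ᴴ = symUnit a δ ε := by
  rw [symUnit, symUnit, ← conjTranspose_symEmb, conjTranspose_mul, conjTranspose_conjTranspose,
    conjTranspose_symEmb]

theorem transpose_embProj (ε : ℤˣ) : (embProj a ε)ᵀ = embProj a ε := by
  rw [embProj, transpose_smul, transpose_symUnit]

theorem conjTranspose_embProj (ε : ℤˣ) : (embProj a ε)ᴴ = embProj a ε := by
  simp [embProj, conjTranspose_smul, conjTranspose_symUnit]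

theorem transpose_tracelessProj (ε : ℤˣ) : (tracelessProj a ε)ᵀ = tracelessProj a ε := by
  rw [tracelessProj, transpose_sub, transpose_symProj, transpose_embProj]

theorem conjTranspose_tracelessProj (ε : ℤˣ) : (tracelessProj a ε)ᴴ = tracelessProj a ε := by
  rw [tracelessProj, conjTranspose_sub, conjTranspose_symProj, conjTranspose_embProj]

theorem swap₁₂_mul_tracelessProj (ε : ℤˣ) :
    swap₁₂ a * tracelessProj a ε = ((ε : ℤ) : ℂ) • tracelessProj a ε := by
  rw [tracelessProj, embProj, symUnit, mul_sub, swap₁₂_mul_symProj, Matrix.mul_smul,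
    ← Matrix.mul_assoc, swap₁₂_mul_symEmb, Matrix.smul_mul, smul_comm, smul_sub]

theorem trace_symUnit (ε δ : ℤˣ) : (symUnit a ε δ).trace =
    if ε = δ then Fintype.card a * (Fintype.card a + ((ε : ℤ) : ℂ)) / 2 else 0 := by
  rw [symUnit, trace_mul_comm, transpose_symEmb_mul_symEmb]
  rcases eq_or_ne ε δ with rfl | h
  · simp only [if_pos, trace_smul, trace_one, smul_eq_mul]
    ring
  · rw [if_neg h.symm, if_neg h, trace_zero]

theorem sum_proj_eq_one : tracelessProj a 1 + tracelessProj a (-1) +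
    (embProj a 1 + embProj a (-1)) = 1 := by
  rw [← symProj_one_add_symProj_neg_one, tracelessProj, tracelessProj]
  abel

variable [Nontrivial a]

theorem embProj_mul_symEmb (ε δ : ℤˣ) :
    embProj a ε * symEmb a δ = if ε = δ then symEmb a δ else 0 := by
  rw [embProj, symUnit, Matrix.smul_mul, Matrix.mul_assoc, transpose_symEmb_mul_symEmb]
  split_ifs with h
  · subst h
    rw [Matrix.mul_smul, Matrix.mul_one, smul_smul, div_mul_div_cancel₀ (card_add_sign_ne_zero a ε),
      div_self two_ne_zero, one_smul]
  · rw [Matrix.mul_zero, smul_zero]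

theorem tracelessProj_mul_symEmb (ε δ : ℤˣ) : tracelessProj a ε * symEmb a δ = 0 := by
  rw [tracelessProj, Matrix.sub_mul, symProj_mul_symEmb, embProj_mul_symEmb, sub_self]

theorem tracelessProj_mul_symUnit (ε δ γ : ℤˣ) : tracelessProj a ε * symUnit a δ γ = 0 := by
  rw [symUnit, ← Matrix.mul_assoc, tracelessProj_mul_symEmb, Matrix.zero_mul]

theorem embProj_mul_symUnit (ε δ γ : ℤˣ) :
    embProj a ε * symUnit a δ γ = if ε = δ then symUnit a δ γ else 0 := by
  rw [symUnit, ← Matrix.mul_assoc, embProj_mul_symEmb]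
  split_ifs <;> simp

theorem symUnit_mul_embProj (γ δ ε : ℤˣ) :
    symUnit a γ δ * embProj a ε = if ε = δ then symUnit a γ δ else 0 := by
  rw [← transpose_transpose (symUnit a γ δ * _), transpose_mul, transpose_embProj,
    transpose_symUnit, embProj_mul_symUnit]
  split_ifs <;> simp [transpose_symUnit]

theorem tracelessProj_mul_embProj (ε δ : ℤˣ) : tracelessProj a ε * embProj a δ = 0 := by
  rw [embProj, Matrix.mul_smul, tracelessProj_mul_symUnit, smul_zero]

theorem embProj_mul_tracelessProj (δ ε : ℤˣ) : embProj a δ * tracelessProj a ε = 0 := by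
  rw [← transpose_transpose (embProj a δ * _), transpose_mul, transpose_embProj,
    transpose_tracelessProj, tracelessProj_mul_embProj, transpose_zero]

theorem embProj_mul_embProj (ε δ : ℤˣ) :
    embProj a ε * embProj a δ = if ε = δ then embProj a δ else 0 := by
  conv_lhs => rw [embProj.eq_def a δ, Matrix.mul_smul, embProj_mul_symUnit]
  split_ifs
  · rfl
  · rw [smul_zero]

theorem tracelessProj_mul_tracelessProj (ε δ : ℤˣ) :
    tracelessProj a ε * tracelessProj a δ = if ε = δ then tracelessProj a δ else 0 := by
  have hsymProj : symProj a ε * tracelessProj a δ = if ε = δ then tracelessProj a δ else 0 := by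
    rw [tracelessProj, Matrix.mul_sub, symProj_mul_symProj, embProj, Matrix.mul_smul, symUnit,
      ← Matrix.mul_assoc, symProj_mul_symEmb]
    split_ifs <;> simp
  rw [tracelessProj.eq_def a ε, Matrix.sub_mul, embProj_mul_tracelessProj, sub_zero, hsymProj]

theorem isStarProjection_embProj (ε : ℤˣ) : IsStarProjection (embProj a ε) :=
  ⟨(embProj_mul_embProj a ε ε).trans (if_pos rfl), conjTranspose_embProj a ε⟩

theorem isStarProjection_tracelessProj (ε : ℤˣ) : IsStarProjection (tracelessProj a ε) :=
  ⟨(tracelessProj_mul_tracelessProj a ε ε).trans (if_pos rfl), conjTranspose_tracelessProj a ε⟩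

theorem trace_embProj (ε : ℤˣ) : (embProj a ε).trace = Fintype.card a := by
  have := card_add_sign_ne_zero a ε
  rw [embProj, trace_smul, trace_symUnit, if_pos rfl, smul_eq_mul]
  field_simp

theorem trace_tracelessProj (ε : ℤˣ) : (tracelessProj a ε).trace =
    (Fintype.card a : ℂ) ^ 2 * (Fintype.card a + ((ε : ℤ) : ℂ)) / 2 - Fintype.card a := by
  rw [tracelessProj, trace_sub, trace_symProj, trace_embProj]

end TripleAlgebra

section PartialTranspose

variable {m n R : Type*} [CommSemiring R]

/-- The transpose of the second tensor factor. -/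
def partialTranspose : Matrix (m × n) (m × n) R →ₗ[R] Matrix (m × n) (m × n) R where
  toFun X := Matrix.of fun p q => X (p.1, q.2) (q.1, p.2)
  map_add' _ _ := rfl
  map_smul' _ _ := rfl

theorem partialTranspose_apply (X : Matrix (m × n) (m × n) R) (p q : m × n) :
    partialTranspose X p q = X (p.1, q.2) (q.1, p.2) := rfl

theorem partialTranspose_kronecker_mul_mul [Fintype m] [Fintype n]
    (K₁ L₁ : Matrix m m R) (K₂ L₂ : Matrix n n R) (X : Matrix (m × n) (m × n) R) :
    partialTranspose (K₁ ⊗ₖ K₂ * X * L₁ ⊗ₖ L₂) =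
      K₁ ⊗ₖ L₂ᵀ * partialTranspose X * L₁ ⊗ₖ K₂ᵀ := by
  ext p q
  simp only [partialTranspose_apply, Matrix.mul_apply, kroneckerMap_apply, transpose_apply,
    Fintype.sum_prod_type, Finset.sum_mul]
  refine Finset.sum_congr rfl fun i _ => ?_
  rw [Finset.sum_comm]
  conv_rhs => rw [Finset.sum_comm]
  refine Finset.sum_congr rfl fun k _ => ?_
  rw [Finset.sum_comm]
  refine Finset.sum_congr rfl fun l _ => Finset.sum_congr rfl fun j _ => ?_
  ring

end PartialTranspose

section TripleRep

variable {a : Type*} [Fintype a] [DecidableEq a]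

/-- The representation `U ↦ Ū ⊗ Ū ⊗ U` of the unitary group. -/
def tripleRep : unitaryGroup a ℂ →ₜ* unitaryGroup ((a × a) × a) ℂ where
  toFun U := ⟨(U.1.map star ⊗ₖ U.1.map star) ⊗ₖ U.1,
    kronecker_mem_unitary (kronecker_mem_unitary (map_star_mem_unitaryGroup_iff.mpr U.2)
      (map_star_mem_unitaryGroup_iff.mpr U.2)) U.2⟩
  map_one' := Subtype.ext <| by simp [Matrix.map_one]
  map_mul' U V := Subtype.ext <| by simp [mul_kronecker_mul]
  continuous_toFun := by
    have hentry (i j : a) : Continuous fun U : unitaryGroup a ℂ => U.1 i j :=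
      continuous_subtype_val.matrix_elem i j
    refine Continuous.subtype_mk (continuous_matrix fun p q => ?_) _
    exact (((hentry _ _).star).mul ((hentry _ _).star)).mul (hentry _ _)

theorem coe_tripleRep (U : unitaryGroup a ℂ) : (tripleRep U).1 =
    (U.1.map star ⊗ₖ U.1.map star) ⊗ₖ U.1 := rfl

theorem commute_tripleRep_swap₁₂ (U : unitaryGroup a ℂ) :
    Commute (tripleRep U).1 (swap₁₂ a) := by
  have h (V : Matrix a a ℂ) : V ⊗ₖ V * swapOp a = swapOp a * V ⊗ₖ V := by
    rw [← transpose_transpose (V ⊗ₖ V * _), transpose_mul, transpose_swapOp,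
      ← kroneckerMap_transpose, swapOp_mul, swapOp_mul]
    ext p q
    exact mul_comm _ _
  rw [Commute, SemiconjBy, coe_tripleRep, swap₁₂, ← mul_kronecker_mul, ← mul_kronecker_mul, h,
    Matrix.mul_one, Matrix.one_mul]

theorem commute_tripleRep_symProj (U : unitaryGroup a ℂ) (ε : ℤˣ) :
    Commute (tripleRep U).1 (symProj a ε) :=
  ((Commute.one_right _).add_right ((commute_tripleRep_swap₁₂ U).smul_right _)).smul_right _

theorem tripleRep_mul_pairEmb (U : unitaryGroup a ℂ) :
    (tripleRep U).1 * pairEmb a = pairEmb a * U.1.map star := by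
  ext p m
  have hU : ∑ n, U.1 p.2 n * star (U.1 p.1.1 n) = if p.2 = p.1.1 then 1 else 0 := by
    rw [← Matrix.one_apply, ← mem_unitaryGroup_iff.mp U.2]
    rfl
  calc ((tripleRep U).1 * pairEmb a) p m
      = ∑ n, star (U.1 p.1.1 n) * star (U.1 p.1.2 m) * U.1 p.2 n := by
        simp [coe_tripleRep, Matrix.mul_apply, pairEmb, Fintype.sum_prod_type, ite_and]
    _ = (∑ n, U.1 p.2 n * star (U.1 p.1.1 n)) * star (U.1 p.1.2 m) := by
        rw [Finset.sum_mul]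
        exact Finset.sum_congr rfl fun n _ => by ring
    _ = (pairEmb a * U.1.map star) p m := by
        rw [hU]
        simp [Matrix.mul_apply, pairEmb, ite_and, eq_comm]

theorem tripleRep_mul_symEmb (U : unitaryGroup a ℂ) (ε : ℤˣ) :
    (tripleRep U).1 * symEmb a ε = symEmb a ε * U.1.map star := by
  rw [symEmb, ← Matrix.mul_assoc, (commute_tripleRep_symProj U ε).eq, Matrix.mul_assoc,
    tripleRep_mul_pairEmb, Matrix.mul_assoc]

theorem transpose_symEmb_mul_tripleRep (U : unitaryGroup a ℂ) (ε : ℤˣ) :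
    (symEmb a ε)ᵀ * (tripleRep U).1 = U.1.map star * (symEmb a ε)ᵀ := by
  have h := congrArg conjTranspose (tripleRep_mul_symEmb U⁻¹ ε)
  rw [map_inv, conjTranspose_mul, conjTranspose_mul, conjTranspose_symEmb] at h
  convert h using 2
  · exact (conjTranspose_conjTranspose _).symm
  · ext i j
    simp

theorem commute_tripleRep_symUnit (U : unitaryGroup a ℂ) (ε δ : ℤˣ) :
    Commute (tripleRep U).1 (symUnit a ε δ) := by
  rw [Commute, SemiconjBy, symUnit, ← Matrix.mul_assoc, tripleRep_mul_symEmb, Matrix.mul_assoc,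
    ← transpose_symEmb_mul_tripleRep, Matrix.mul_assoc]

theorem commute_tripleRep_embProj (U : unitaryGroup a ℂ) (ε : ℤˣ) :
    Commute (tripleRep U).1 (embProj a ε) :=
  (commute_tripleRep_symUnit U ε ε).smul_right _

theorem commute_tripleRep_tracelessProj (U : unitaryGroup a ℂ) (ε : ℤˣ) :
    Commute (tripleRep U).1 (tracelessProj a ε) :=
  (commute_tripleRep_symProj U ε).sub_right (commute_tripleRep_embProj U ε)

end TripleRep

section Commutant

theorem commute_iff_mul_mul_conjTranspose {n : Type*} [Fintype n] [DecidableEq n]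
    {U X : Matrix n n ℂ} (hU : U ∈ unitaryGroup n ℂ) : Commute X U ↔ U * X * Uᴴ = X := by
  rw [Commute, SemiconjBy, ← star_eq_conjTranspose]
  constructor <;> intro h
  · rw [← h, Matrix.mul_assoc, mem_unitaryGroup_iff.mp hU, Matrix.mul_one]
  · rw [← congrArg (· * U) h, Matrix.mul_assoc, mem_unitaryGroup_iff'.mp hU, Matrix.mul_one]

variable {a : Type*}

/-- Three tensor factors as a tensor power indexed by `Fin 3`. -/
def tripleEquiv : (a × a) × a ≃ (Fin 3 → a) where
  toFun p := ![p.1.1, p.1.2, p.2]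
  invFun f := ((f 0, f 1), f 2)
  left_inv _ := rfl
  right_inv f := by
    ext i
    fin_cases i <;> rfl

theorem reindex_tripleEquiv_kronecker (V : Matrix a a ℂ) :
    reindex tripleEquiv tripleEquiv ((V ⊗ₖ V) ⊗ₖ V) = tensorPower (Fin 3) V := by
  ext p q
  simp only [tensorPower, of_apply, Fin.prod_univ_three]
  rfl

variable [Fintype a] [DecidableEq a]

theorem commute_reindex_partialTranspose_tensorPower {X : Matrix ((a × a) × a) ((a × a) × a) ℂ}
    (hX : ∀ U : unitaryGroup a ℂ, Commute X (tripleRep U).1) {V : Matrix a a ℂ}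
    (hV : V ∈ unitaryGroup a ℂ) :
    Commute (reindex tripleEquiv tripleEquiv (partialTranspose X)) (tensorPower (Fin 3) V) := by
  let U : unitaryGroup a ℂ := ⟨V.map star, map_star_mem_unitaryGroup_iff.mpr hV⟩
  have hstar : U.1.map star = V := by
    ext i j
    exact star_star _
  have hU : (tripleRep U).1 = (V ⊗ₖ V) ⊗ₖ V.map star := by
    rw [coe_tripleRep, hstar]
  have hX' := congrArg partialTranspose
    ((commute_iff_mul_mul_conjTranspose (tripleRep U).2).mp (hX U))
  have hadj : ((V.map star)ᴴ)ᵀ = V := hstar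
  have htr : (V.map star)ᵀ = Vᴴ := rfl
  rw [hU, conjTranspose_kronecker, partialTranspose_kronecker_mul_mul, hadj, htr,
    ← conjTranspose_kronecker, ← commute_iff_mul_mul_conjTranspose
      (kronecker_mem_unitary (kronecker_mem_unitary hV hV) hV)] at hX'
  rw [← reindex_tripleEquiv_kronecker]
  exact hX'.map (reindexAlgEquiv ℂ ℂ tripleEquiv)

theorem perm_fin_three_cases (σ : Equiv.Perm (Fin 3)) : σ = 1 ∨ σ = Equiv.swap 0 1 * 1 ∨
    σ = Equiv.swap 0 2 ∨ σ = Equiv.swap 0 1 * Equiv.swap 0 2 ∨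
    σ = Equiv.swap 0 2 * Equiv.swap 0 1 ∨
    σ = Equiv.swap 0 1 * (Equiv.swap 0 2 * Equiv.swap 0 1) := by
  decide +revert

variable (a) in
/-- The partial transposes of the permutations of three tensor factors. -/
def brauer (σ : Equiv.Perm (Fin 3)) : Matrix ((a × a) × a) ((a × a) × a) ℂ :=
  partialTranspose (reindex tripleEquiv.symm tripleEquiv.symm (tensorPerm ℂ σ))

theorem brauer_apply (σ : Equiv.Perm (Fin 3)) (p q : (a × a) × a) : brauer a σ p q =
    if ∀ i, ![p.1.1, p.1.2, q.2] (σ i) = ![q.1.1, q.1.2, p.2] i then 1 else 0 := by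
  simp only [← Function.comp_apply (g := σ), ← funext_iff]
  rfl

theorem brauer_one : brauer a 1 = 1 := by
  ext p q
  simp [brauer_apply, Fin.forall_fin_succ, Matrix.one_apply, Prod.ext_iff, and_assoc, eq_comm]

theorem brauer_swap_zero_two : brauer a (Equiv.swap 0 2) = pairEmb a * (pairEmb a)ᵀ := by
  have h : Equiv.swap (0 : Fin 3) 2 1 = 1 := by decide
  ext p q
  by_cases hp : p.1.1 = p.2 <;> by_cases hq : q.1.1 = q.2 <;>
    simp [brauer_apply, Fin.forall_fin_succ, pairEmb, Matrix.mul_apply, h, hp, hq, eq_comm]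

theorem mul_swap₁₂_apply (X : Matrix ((a × a) × a) ((a × a) × a) ℂ) (p q : (a × a) × a) :
    (X * swap₁₂ a) p q = X p (q.1.swap, q.2) := by
  rw [← transpose_apply (X * _), transpose_mul, transpose_swap₁₂, swap₁₂_mul_apply,
    transpose_apply]

theorem brauer_swap_zero_one_mul (σ : Equiv.Perm (Fin 3)) :
    brauer a (Equiv.swap 0 1 * σ) = swap₁₂ a * brauer a σ := by
  ext p q
  have h (i : Fin 3) :
      ![p.1.1, p.1.2, q.2] (Equiv.swap 0 1 i) = ![p.1.2, p.1.1, q.2] i := by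
    fin_cases i <;> rfl
  simp only [swap₁₂_mul_apply, brauer_apply, Equiv.Perm.mul_apply, h, Prod.fst_swap, Prod.snd_swap]

theorem brauer_mul_swap_zero_one (σ : Equiv.Perm (Fin 3)) :
    brauer a (σ * Equiv.swap 0 1) = brauer a σ * swap₁₂ a := by
  ext p q
  have h (i : Fin 3) :
      ![q.1.1, q.1.2, p.2] (Equiv.swap 0 1 i) = ![q.1.2, q.1.1, p.2] i := by
    fin_cases i <;> rfl
  rw [mul_swap₁₂_apply, brauer_apply, brauer_apply]
  refine if_congr ((Equiv.swap (0 : Fin 3) 1).forall_congr fun i => ?_) rfl rfl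
  simp only [← h, Equiv.Perm.mul_apply, Prod.fst_swap, Prod.snd_swap, Equiv.swap_apply_self]

variable (a) in
/-- The span of the traceless projections and the matrix units of `ℂ^a ⊗ ℂ²`, which turns out to
be the commutant of `tripleRep`. -/
noncomputable def tripleAlgebra : Submodule ℂ (Matrix ((a × a) × a) ((a × a) × a) ℂ) :=
  Submodule.span ℂ (Set.range (tracelessProj a) ∪ Set.range fun x : ℤˣ × ℤˣ => symUnit a x.1 x.2)

theorem tracelessProj_mem_tripleAlgebra (ε : ℤˣ) : tracelessProj a ε ∈ tripleAlgebra a :=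
  Submodule.subset_span (.inl ⟨ε, rfl⟩)

theorem symUnit_mem_tripleAlgebra (ε δ : ℤˣ) : symUnit a ε δ ∈ tripleAlgebra a :=
  Submodule.subset_span (.inr ⟨(ε, δ), rfl⟩)

theorem embProj_mem_tripleAlgebra (ε : ℤˣ) : embProj a ε ∈ tripleAlgebra a :=
  Submodule.smul_mem _ _ (symUnit_mem_tripleAlgebra ε ε)

theorem tripleAlgebra_le {S : Submodule ℂ (Matrix ((a × a) × a) ((a × a) × a) ℂ)}
    (htraceless : ∀ ε, tracelessProj a ε ∈ S) (hunit : ∀ ε δ, symUnit a ε δ ∈ S) :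
    tripleAlgebra a ≤ S := by
  rw [tripleAlgebra, Submodule.span_le, Set.union_subset_iff, Set.range_subset_iff,
    Set.range_subset_iff]
  exact ⟨htraceless, fun x => hunit x.1 x.2⟩

theorem swap₁₂_mul_symUnit (ε δ : ℤˣ) :
    swap₁₂ a * symUnit a ε δ = ((ε : ℤ) : ℂ) • symUnit a ε δ := by
  rw [symUnit, ← Matrix.mul_assoc, swap₁₂_mul_symEmb, Matrix.smul_mul]

theorem swap₁₂_mul_mem_tripleAlgebra {X : Matrix ((a × a) × a) ((a × a) × a) ℂ}
    (hX : X ∈ tripleAlgebra a) : swap₁₂ a * X ∈ tripleAlgebra a := by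
  refine tripleAlgebra_le (S := (tripleAlgebra a).comap (LinearMap.mulLeft ℂ (swap₁₂ a)))
    (fun ε => ?_) (fun ε δ => ?_) hX <;> rw [Submodule.mem_comap, LinearMap.mulLeft_apply]
  · rw [swap₁₂_mul_tracelessProj]
    exact Submodule.smul_mem _ _ (tracelessProj_mem_tripleAlgebra ε)
  · rw [swap₁₂_mul_symUnit]
    exact Submodule.smul_mem _ _ (symUnit_mem_tripleAlgebra ε δ)

theorem mul_swap₁₂_mem_tripleAlgebra {X : Matrix ((a × a) × a) ((a × a) × a) ℂ}
    (hX : X ∈ tripleAlgebra a) : X * swap₁₂ a ∈ tripleAlgebra a := by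
  refine tripleAlgebra_le (S := (tripleAlgebra a).comap (LinearMap.mulRight ℂ (swap₁₂ a)))
    (fun ε => ?_) (fun ε δ => ?_) hX <;>
    rw [Submodule.mem_comap, LinearMap.mulRight_apply, ← transpose_transpose (_ * _),
      transpose_mul, transpose_swap₁₂]
  · rw [transpose_tracelessProj, swap₁₂_mul_tracelessProj, transpose_smul,
      transpose_tracelessProj]
    exact Submodule.smul_mem _ _ (tracelessProj_mem_tripleAlgebra ε)
  · rw [transpose_symUnit, swap₁₂_mul_symUnit, transpose_smul, transpose_symUnit]
    exact Submodule.smul_mem _ _ (symUnit_mem_tripleAlgebra ε δ)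

theorem one_mem_tripleAlgebra : 1 ∈ tripleAlgebra a :=
  sum_proj_eq_one a ▸ add_mem
    (add_mem (tracelessProj_mem_tripleAlgebra 1) (tracelessProj_mem_tripleAlgebra (-1)))
    (add_mem (embProj_mem_tripleAlgebra 1) (embProj_mem_tripleAlgebra (-1)))

theorem pairEmb_mul_transpose_mem_tripleAlgebra :
    pairEmb a * (pairEmb a)ᵀ ∈ tripleAlgebra a := by
  rw [← symEmb_one_add_symEmb_neg_one, transpose_add, Matrix.add_mul, Matrix.mul_add,
    Matrix.mul_add]
  exact add_mem (add_mem (symUnit_mem_tripleAlgebra 1 1) (symUnit_mem_tripleAlgebra 1 (-1)))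
    (add_mem (symUnit_mem_tripleAlgebra (-1) 1) (symUnit_mem_tripleAlgebra (-1) (-1)))

theorem brauer_mem_tripleAlgebra (σ : Equiv.Perm (Fin 3)) : brauer a σ ∈ tripleAlgebra a := by
  have hone : brauer a 1 ∈ tripleAlgebra a := brauer_one (a := a) ▸ one_mem_tripleAlgebra
  have hpair : brauer a (Equiv.swap 0 2) ∈ tripleAlgebra a :=
    brauer_swap_zero_two (a := a) ▸ pairEmb_mul_transpose_mem_tripleAlgebra
  rcases perm_fin_three_cases σ with rfl | rfl | rfl | rfl | rfl | rfl <;>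
    simp only [brauer_swap_zero_one_mul, brauer_mul_swap_zero_one, hone, hpair,
      swap₁₂_mul_mem_tripleAlgebra, mul_swap₁₂_mem_tripleAlgebra]

theorem mem_tripleAlgebra_of_commute {X : Matrix ((a × a) × a) ((a × a) × a) ℂ}
    (hX : ∀ U : unitaryGroup a ℂ, Commute X (tripleRep U).1) : X ∈ tripleAlgebra a := by
  let Γ := partialTranspose (R := ℂ) ∘ₗ
    (reindexLinearEquiv ℂ ℂ (tripleEquiv (a := a)).symm tripleEquiv.symm).toLinearMap
  have hspan := mem_span_range_tensorPerm fun V hV =>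
    commute_reindex_partialTranspose_tensorPower hX hV
  have hΓ : Submodule.map Γ (Submodule.span ℂ (Set.range (tensorPerm ℂ))) ≤ tripleAlgebra a :=
    (Submodule.map_span_le _ _ _).mpr fun _ ⟨σ, hσ⟩ => hσ ▸ brauer_mem_tripleAlgebra σ
  exact hΓ ⟨_, hspan, rfl⟩

end Commutant

section Channels

variable {a b c e : Type}

open scoped MatrixOrder in
theorem exists_conjTranspose_mul_self {n : Type*} [Fintype n] {M : Matrix n n ℂ}
    (hM : M.PosSemidef) : ∃ B : Matrix n n ℂ, M = Bᴴ * B := by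
  classical
  exact CStarAlgebra.nonneg_iff_eq_star_mul_self.mp (Matrix.nonneg_iff_posSemidef.mpr hM)

theorem choi_apply [DecidableEq a] (Φ : OpMap a b) (p q : b × a) :
    choi Φ p q = Φ (Matrix.single p.2 q.2 1) p.1 q.1 := rfl

theorem choi_add [DecidableEq a] (Φ Ψ : OpMap a b) : choi (Φ + Ψ) = choi Φ + choi Ψ := rfl

theorem choi_sub [DecidableEq a] (Φ Ψ : OpMap a b) : choi (Φ - Ψ) = choi Φ - choi Ψ := rfl

theorem choi_smul [DecidableEq a] (r : ℂ) (Φ : OpMap a b) : choi (r • Φ) = r • choi Φ := rfl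

theorem choi_sum [DecidableEq a] {ι : Type*} (s : Finset ι) (Φ : ι → OpMap a b) :
    choi (∑ i ∈ s, Φ i) = ∑ i ∈ s, choi (Φ i) := by
  ext p q
  simp [choi_apply, Matrix.sum_apply]

theorem tensorMap_id_apply [Fintype c] [DecidableEq c] (Φ : OpMap a b)
    (X : Matrix (a × c) (a × c) ℂ) (p q : b × c) :
    tensorMap Φ (LinearMap.id : OpMap c c) X p q = Φ (block p.2 q.2 X) p.1 q.1 := by
  simp [tensorMap_apply, Matrix.single_apply, ite_and]

theorem block_tensorMap_id [Fintype c] [DecidableEq c] (Φ : OpMap a b)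
    (X : Matrix (a × c) (a × c) ℂ) (m n : c) :
    block m n (tensorMap Φ (LinearMap.id : OpMap c c) X) = Φ (block m n X) := by
  ext i j
  exact tensorMap_id_apply Φ X (i, m) (j, n)

theorem block_single [DecidableEq a] [DecidableEq c] (m n : c) (p q : a × c) :
    block m n (Matrix.single p q (1 : ℂ)) =
      (if p.2 = m ∧ q.2 = n then 1 else 0 : ℂ) • Matrix.single p.1 q.1 1 := by
  ext i j
  simp only [block_apply, Matrix.single_apply, Matrix.smul_apply, smul_eq_mul, Prod.ext_iff]
  split_ifs <;> simp_all

theorem choi_tensorMap [DecidableEq a] [Fintype c] [DecidableEq c] (Φ : OpMap a b)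
    (Ψ : OpMap c e) :
    choi (tensorMap Φ Ψ) = (choi Φ ⊗ₖ choi Ψ).submatrix
      (fun p => ((p.1.1, p.2.1), (p.1.2, p.2.2))) (fun p => ((p.1.1, p.2.1), (p.1.2, p.2.2))) := by
  ext p q
  simp only [choi_apply, tensorMap_apply, block_single, map_smul, Matrix.smul_apply, smul_eq_mul,
    ite_and, ite_mul, one_mul, zero_mul, Finset.sum_ite_irrel, Finset.sum_const_zero,
    Finset.sum_ite_eq, Finset.mem_univ, if_true, Matrix.submatrix_apply,
    Matrix.kroneckerMap_apply]

theorem trace_tensorMap [Fintype b] [Fintype c] [DecidableEq c] [Fintype e] (Φ : OpMap a b)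
    (Ψ : OpMap c e) (X : Matrix (a × c) (a × c) ℂ) :
    (tensorMap Φ Ψ X).trace =
      ∑ m, ∑ n, (Φ (block m n X)).trace * (Ψ (Matrix.single m n 1)).trace := by
  simp only [Matrix.trace, Matrix.diag_apply, tensorMap_apply, Fintype.sum_prod_type,
    Finset.sum_mul_sum]
  simp only [Finset.sum_comm (s := (Finset.univ : Finset c)) (t := (Finset.univ : Finset e)),
    Finset.sum_comm (s := (Finset.univ : Finset c)) (t := (Finset.univ : Finset b))]

theorem IsCP.comp {Φ : OpMap b e} {Ψ : OpMap a b} (hΦ : IsCP Φ)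
    (hΨ : IsCP Ψ) : IsCP (Φ ∘ₗ Ψ) := by
  intro k X hX
  convert hΦ k _ (hΨ k X hX)
  ext p q
  rw [tensorMap_id_apply, tensorMap_id_apply, block_tensorMap_id, LinearMap.comp_apply]

theorem IsChannel.comp [Fintype a] [Fintype b] [Fintype e] {Φ : OpMap b e}
    {Ψ : OpMap a b} (hΦ : IsChannel Φ) (hΨ : IsChannel Ψ) : IsChannel (Φ ∘ₗ Ψ) :=
  ⟨hΦ.1.comp hΨ.1, fun X => by rw [LinearMap.comp_apply, hΦ.2, hΨ.2]⟩

theorem trace_reduced [Fintype b] [Fintype e] (M : OpMap (a × c) (b × e)) (σ : Matrix c c ℂ)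
    (X : Matrix a a ℂ) : (reduced M σ X).trace = (M (X ⊗ₖ σ)).trace := by
  simp only [Matrix.trace, Matrix.diag_apply, Fintype.sum_prod_type]
  rfl

/-- The unnormalised projection `∑ m n, |m⟩⟨n| ⊗ |f m⟩⟨f n|` onto a maximally entangled vector
of `ℂ^a ⊗ ℂ^c`. -/
def maxEntangled [DecidableEq c] (f : a ≃ c) : Matrix (a × c) (a × c) ℂ :=
  Matrix.vecMulVec (fun p => if f p.1 = p.2 then 1 else 0)
    (star fun p => if f p.1 = p.2 then 1 else 0)

theorem posSemidef_maxEntangled [Finite a] [Finite c] [DecidableEq c] (f : a ≃ c) :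
    (maxEntangled f).PosSemidef :=
  Matrix.posSemidef_vecMulVec_self_star _

theorem block_maxEntangled [DecidableEq a] [DecidableEq c] (f : a ≃ c) (m n : a) :
    block (f m) (f n) (maxEntangled f) = Matrix.single m n 1 := by
  ext i j
  change maxEntangled f (i, f m) (j, f n) = _
  simp [maxEntangled, Matrix.vecMulVec_apply, Matrix.single_apply, eq_comm, ← ite_and, and_comm]

theorem trace_maxEntangled [Fintype a] [Fintype c] [DecidableEq c] (f : a ≃ c) :
    (maxEntangled f).trace = Fintype.card a := by
  simp [maxEntangled, Matrix.trace, Matrix.vecMulVec_apply, Fintype.sum_prod_type]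

variable [Fintype a]

theorem tensorMap_conjBy_id [Fintype c] [DecidableEq c] (K : Matrix b a ℂ)
    (X : Matrix (a × c) (a × c) ℂ) :
    tensorMap (conjBy K) (LinearMap.id : OpMap c c) X =
      (K ⊗ₖ (1 : Matrix c c ℂ)) * X * (K ⊗ₖ (1 : Matrix c c ℂ))ᴴ := by
  ext p q
  rw [tensorMap_id_apply]
  simp [conjBy, sandwich_apply, Matrix.mul_apply, Fintype.sum_prod_type, Matrix.one_apply,
    block_apply, apply_ite (starRingEnd ℂ)]

theorem krausMap_apply {ι : Type} [Fintype ι] (K : ι → Matrix b a ℂ) (X : Matrix a a ℂ) :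
    krausMap K X = ∑ i, K i * X * (K i)ᴴ := by
  simp [krausMap, conjBy, sandwich_apply]

theorem isCP_krausMap [Finite b] {ι : Type} [Fintype ι] (K : ι → Matrix b a ℂ) :
    IsCP (krausMap K) := by
  have := Fintype.ofFinite b
  intro k X hX
  have h_sum : tensorMap (krausMap K) (LinearMap.id : OpMap (Fin k) (Fin k)) X =
      ∑ i, tensorMap (conjBy (K i)) (LinearMap.id : OpMap (Fin k) (Fin k)) X := by
    ext p q
    simp only [tensorMap_id_apply, krausMap, LinearMap.sum_apply, Matrix.sum_apply]
  rw [h_sum]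
  refine Matrix.posSemidef_sum _ fun i _ => ?_
  rw [tensorMap_conjBy_id]
  exact hX.mul_mul_conjTranspose_same _

theorem isCP_conjBy [Finite b] (K : Matrix b a ℂ) : IsCP (conjBy K) := by
  simpa [krausMap] using isCP_krausMap fun _ : Unit => K

variable [DecidableEq a]

theorem apply_eq_sum_choi (Φ : OpMap a b) (X : Matrix a a ℂ) (i j : b) :
    Φ X i j = ∑ m, ∑ n, X m n * choi Φ (i, m) (j, n) := by
  conv_lhs => rw [Matrix.matrix_eq_sum_single X]
  simp only [map_sum, Matrix.sum_apply, choi_apply]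
  refine Finset.sum_congr rfl fun m _ => Finset.sum_congr rfl fun n _ => ?_
  rw [← smul_eq_mul, ← Matrix.smul_apply, ← map_smul, Matrix.smul_single, smul_eq_mul, mul_one]

omit [Fintype a] in
theorem choi_injective [Finite a] :
    Function.Injective (choi : OpMap a b → Matrix (b × a) (b × a) ℂ) := by
  have := Fintype.ofFinite a
  intro Φ Ψ h
  refine LinearMap.ext fun X => ?_
  ext i j
  rw [apply_eq_sum_choi, apply_eq_sum_choi, h]

theorem choi_sandwich (A B : Matrix b a ℂ) (p q : b × a) :
    choi (sandwich A B) p q = A p.1 p.2 * star (B q.1 q.2) := by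
  simp [choi_apply, sandwich_apply, Matrix.mul_apply, Matrix.single_apply, ite_and]

theorem isChannel_krausMap [Fintype b] {ι : Type} [Fintype ι]
    {K : ι → Matrix b a ℂ} (h : ∑ i, (K i)ᴴ * K i = 1) : IsChannel (krausMap K) := by
  refine ⟨isCP_krausMap K, fun X => ?_⟩
  simp only [krausMap_apply, Matrix.trace_sum, Matrix.trace_mul_comm _ (_)ᴴ, ← Matrix.mul_assoc]
  rw [← Matrix.trace_sum, ← Matrix.sum_mul, h, Matrix.one_mul]

theorem isChannel_conjBy [Fintype b] {K : Matrix b a ℂ} (h : Kᴴ * K = 1) :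
    IsChannel (conjBy K) := by
  simpa [krausMap] using isChannel_krausMap (K := fun _ : Unit => K) (by simpa)

theorem conjBy_one : conjBy (1 : Matrix a a ℂ) = LinearMap.id :=
  LinearMap.ext fun X => by simp [conjBy, sandwich_apply]

omit [DecidableEq a] in
theorem isChannel_id : IsChannel (LinearMap.id : OpMap a a) := by
  classical
  rw [← conjBy_one]
  exact isChannel_conjBy (by simp)

omit [Fintype a] in
theorem IsCP.posSemidef_choi [Finite a] {Φ : OpMap a b} (h : IsCP Φ) : (choi Φ).PosSemidef := by
  have := Fintype.ofFinite a
  let f := Fintype.equivFin a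
  convert (h _ _ (posSemidef_maxEntangled f)).submatrix fun p : b × a => (p.1, f p.2)
  ext p q
  rw [Matrix.submatrix_apply, tensorMap_id_apply, choi_apply, block_maxEntangled]

theorem exists_eq_krausMap_of_posSemidef_choi [Fintype b] {Φ : OpMap a b}
    (h : (choi Φ).PosSemidef) : ∃ K : b × a → Matrix b a ℂ, Φ = krausMap K := by
  obtain ⟨B, hB⟩ := exists_conjTranspose_mul_self h
  refine ⟨fun κ => Matrix.of fun i m => star (B κ (i, m)), choi_injective ?_⟩
  ext p q
  simp [krausMap, choi_sum, conjBy, choi_sandwich, Matrix.sum_apply, hB, Matrix.mul_apply]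

omit [Fintype a] in
theorem isCP_iff_posSemidef_choi [Finite a] [Finite b] {Φ : OpMap a b} :
    IsCP Φ ↔ (choi Φ).PosSemidef := by
  have := Fintype.ofFinite a
  have := Fintype.ofFinite b
  refine ⟨IsCP.posSemidef_choi, fun h => ?_⟩
  obtain ⟨K, rfl⟩ := exists_eq_krausMap_of_posSemidef_choi h
  exact isCP_krausMap K

variable [Fintype b] [Fintype c] [DecidableEq c] [Fintype e]

omit [DecidableEq a] in
theorem isChannel_tensorMap {Φ : OpMap a b} {Ψ : OpMap c e} (hΦ : IsChannel Φ)
    (hΨ : IsChannel Ψ) : IsChannel (tensorMap Φ Ψ) := by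
  classical
  constructor
  · rw [isCP_iff_posSemidef_choi, choi_tensorMap]
    exact (hΦ.1.posSemidef_choi.kronecker hΨ.1.posSemidef_choi).submatrix _
  · intro X
    rw [trace_tensorMap]
    simp only [hΦ.2, hΨ.2]
    rw [Finset.sum_comm]
    simp only [Matrix.trace, Matrix.diag_apply, block_apply, Fintype.sum_prod_type,
      Matrix.single_apply, ite_and, Finset.sum_ite_eq, Finset.mem_univ, if_true, mul_ite, mul_one,
      mul_zero]
    exact Finset.sum_comm

omit [DecidableEq a] in
theorem isNoSignalling_tensorMap {Φ : OpMap a b} {Ψ : OpMap c e} (hΦ : IsChannel Φ)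
    (hΨ : IsChannel Ψ) : IsNoSignalling (tensorMap Φ Ψ) :=
  ⟨isChannel_tensorMap hΦ hΨ, 1, fun _ => 1, fun _ => Φ, fun _ => Ψ, fun _ => hΦ, fun _ => hΨ,
    by simp⟩

omit [DecidableEq c] in
theorem reduced_eq_krausMap_comp [DecidableEq b] [DecidableEq e] (M : OpMap (a × c) (b × e))
    (B : Matrix c c ℂ) :
    reduced M (Bᴴ * B) =
      krausMap (fun k : e => Matrix.of fun i (q : b × e) => if q = (i, k) then (1 : ℂ) else 0) ∘ₗ
        M ∘ₗ krausMap fun κ : c =>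
          Matrix.of fun (p : a × c) i => if p.1 = i then star (B κ p.2) else 0 := by
  refine LinearMap.ext fun X => ?_
  have h_input : X ⊗ₖ (Bᴴ * B) = krausMap (fun κ : c =>
      Matrix.of fun (p : a × c) i => if p.1 = i then star (B κ p.2) else 0) X := by
    ext p q
    simp only [krausMap_apply, Matrix.sum_apply, Matrix.mul_apply, kroneckerMap_apply,
      conjTranspose_apply, of_apply, RCLike.star_def, apply_ite (starRingEnd ℂ), map_zero,
      starRingEnd_self_apply, ite_mul, mul_ite, zero_mul, mul_zero, Finset.sum_ite_eq,
      Finset.mem_univ, if_true, Finset.mul_sum]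
    exact Finset.sum_congr rfl fun κ _ => by ring
  ext i j
  change ∑ k, M (X ⊗ₖ (Bᴴ * B)) (i, k) (j, k) = _
  rw [LinearMap.comp_apply, LinearMap.comp_apply, ← h_input]
  simp [krausMap_apply, Matrix.sum_apply, Matrix.mul_apply, apply_ite (starRingEnd ℂ)]

omit [DecidableEq a] [DecidableEq c] in
theorem isChannel_reduced {M : OpMap (a × c) (b × e)} (hM : IsChannel M) {σ : Matrix c c ℂ}
    (hσ : IsDensity σ) : IsChannel (reduced M σ) := by
  classical
  constructor
  · obtain ⟨B, rfl⟩ := exists_conjTranspose_mul_self hσ.1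
    rw [reduced_eq_krausMap_comp]
    exact (isCP_krausMap _).comp (hM.1.comp (isCP_krausMap _))
  · intro X
    rw [trace_reduced, hM.2, Matrix.trace_kronecker, hσ.2, mul_one]

end Channels

section MeasurePrepare

variable {a b c e : Type} [Fintype a]

/-- The map `ρ ↦ Tr[K ρ] Y`, as a bilinear function of `K` and `Y`. -/
def measurePrepare : Matrix a a ℂ →ₗ[ℂ] Matrix b b ℂ →ₗ[ℂ] OpMap a b :=
  LinearMap.mk₂ ℂ
    (fun K Y => (Matrix.traceLinearMap a ℂ ℂ ∘ₗ LinearMap.mulLeft ℂ K).smulRight Y)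
    (fun K K' Y => LinearMap.ext fun X => by simp [Matrix.add_mul, add_smul])
    (fun r K Y => LinearMap.ext fun X => by simp [smul_smul])
    (fun K Y Y' => LinearMap.ext fun X => by simp)
    (fun r K Y => LinearMap.ext fun X => by simp [smul_comm (_ : ℂ) r])

theorem measurePrepare_apply (K : Matrix a a ℂ) (Y : Matrix b b ℂ) (X : Matrix a a ℂ) :
    measurePrepare K Y X = (K * X).trace • Y := rfl

variable [DecidableEq a]

theorem choi_measurePrepare (K : Matrix a a ℂ) (Y : Matrix b b ℂ) :
    choi (measurePrepare K Y) = Y ⊗ₖ Kᵀ := by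
  ext p q
  simp [choi_apply, measurePrepare_apply, Matrix.trace_mul_single, mul_comm]

omit [DecidableEq a] in
theorem tensorMap_measurePrepare [Fintype c] [DecidableEq c] (K : Matrix a a ℂ) (Y : Matrix b b ℂ)
    (K' : Matrix c c ℂ) (Y' : Matrix e e ℂ) :
    tensorMap (measurePrepare K Y) (measurePrepare K' Y') =
      measurePrepare (K ⊗ₖ K') (Y ⊗ₖ Y') := by
  classical
  apply choi_injective
  rw [choi_tensorMap, choi_measurePrepare, choi_measurePrepare, choi_measurePrepare]
  ext p q
  exact mul_mul_mul_comm _ _ _ _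

variable [Fintype b] [DecidableEq b]

variable (a b) in
/-- The completely depolarizing channel. -/
noncomputable def depolarizing : OpMap a b :=
  measurePrepare 1 ((Fintype.card b : ℂ)⁻¹ • 1)

theorem isChannel_depolarizing [Nonempty b] : IsChannel (depolarizing a b) := by
  constructor
  · rw [isCP_iff_posSemidef_choi, depolarizing, choi_measurePrepare, Matrix.transpose_one]
    refine (Matrix.PosSemidef.one.smul ?_).kronecker Matrix.PosSemidef.one
    exact inv_nonneg.mpr (Nat.cast_nonneg _)
  · intro X
    have h_card : (Fintype.card b : ℂ) ≠ 0 := Nat.cast_ne_zero.mpr Fintype.card_ne_zero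
    simp [depolarizing, measurePrepare_apply, mul_left_comm, h_card]

theorem depolarizing_prod [Fintype c] [DecidableEq c] [Fintype e] [DecidableEq e] :
    depolarizing (a × c) (b × e) = tensorMap (depolarizing a b) (depolarizing c e) := by
  rw [depolarizing, depolarizing, depolarizing, tensorMap_measurePrepare]
  simp [Matrix.smul_kronecker, Matrix.kronecker_smul, smul_smul, mul_comm]

end MeasurePrepare

section SuperChoi

variable {a b c e : Type} [Fintype a] [DecidableEq a] [DecidableEq b] [DecidableEq c]

/-- The Choi operator of a linear transformation of maps. -/
def superChoi (S : OpMap a b →ₗ[ℂ] OpMap c e) :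
    Matrix ((b × c) × (a × e)) ((b × c) × (a × e)) ℂ :=
  Matrix.of fun x y => S (sandwich (Matrix.single x.1.1 x.2.1 1) (Matrix.single y.1.1 y.2.1 1))
    (Matrix.single x.1.2 y.1.2 1) x.2.2 y.2.2

theorem choi_sandwich_single (i j : b) (m n : a) :
    choi (sandwich (Matrix.single i m 1) (Matrix.single j n 1)) =
      Matrix.single (i, m) (j, n) 1 := by
  ext p q
  simp [choi_sandwich, Matrix.single_apply, Prod.ext_iff, ← ite_and, and_comm, and_left_comm,
    and_assoc]

theorem eq_sum_choi_smul_sandwich [Fintype b] (N : OpMap a b) :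
    N = ∑ p, ∑ q, choi N p q • sandwich (Matrix.single p.1 p.2 1) (Matrix.single q.1 q.2 1) := by
  apply choi_injective
  conv_lhs => rw [Matrix.matrix_eq_sum_single (choi N)]
  simp only [choi_sum, choi_smul, choi_sandwich_single, Matrix.smul_single, smul_eq_mul, mul_one]

theorem supermap_apply_single [Fintype b] (S : OpMap a b →ₗ[ℂ] OpMap c e) (N : OpMap a b)
    (k l : c) (i j : e) :
    S N (Matrix.single k l 1) i j = ∑ p : b × a, ∑ q : b × a,
      choi N p q * superChoi S ((p.1, k), (p.2, i)) ((q.1, l), (q.2, j)) := by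
  conv_lhs => rw [eq_sum_choi_smul_sandwich N]
  simp only [map_sum, map_smul, LinearMap.sum_apply, LinearMap.smul_apply, Matrix.sum_apply,
    Matrix.smul_apply, smul_eq_mul, superChoi, Matrix.of_apply]

end SuperChoi

section EntanglingChannel

variable {a b c : Type} [DecidableEq c]

/-- The Kraus operator that prepares the unnormalised maximally entangled vector of two copies of
`ℂ^b` and outputs one copy, next to the register `ℂ^c ≃ ℂ^b ⊗ ℂ^a` holding the other copy and
the input. The one-dimensional input is the ancilla in the definition of a supermap. -/
def entangleKraus (f : b × a ≃ c) : Matrix (b × c) (a × Fin 1) ℂ :=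
  Matrix.of fun p q => if p.2 = f (p.1, q.1) then 1 else 0

theorem conjBy_entangleKraus_kronecker [Fintype a] [DecidableEq b] (f : b × a ≃ c)
    (X : Matrix a a ℂ) (σ : Matrix (Fin 1) (Fin 1) ℂ) (i j : b) (κ κ' : b × a) :
    conjBy (entangleKraus f) (X ⊗ₖ σ) (i, f κ) (j, f κ') =
      if κ.1 = i ∧ κ'.1 = j then X κ.2 κ'.2 * σ 0 0 else 0 := by
  classical
  obtain ⟨β, α⟩ := κ
  obtain ⟨β', α'⟩ := κ'
  by_cases hj : β' = j <;>
    simp [conjBy, sandwich_apply, Matrix.mul_apply, Fintype.sum_prod_type, entangleKraus,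
      apply_ite (starRingEnd ℂ), ite_and, hj]

theorem conjTranspose_mul_entangleKraus [DecidableEq a] [Fintype b] [Fintype c] (f : b × a ≃ c) :
    (entangleKraus f)ᴴ * entangleKraus f = (Fintype.card b : ℂ) • 1 := by
  ext ⟨p, p'⟩ ⟨q, q'⟩
  obtain rfl : p' = q' := Subsingleton.elim _ _
  rcases eq_or_ne p q with rfl | h
  · simp [Matrix.mul_apply, Fintype.sum_prod_type, entangleKraus]
  · simp [Matrix.mul_apply, Fintype.sum_prod_type, entangleKraus, h, h.symm]

variable [Fintype a] [Fintype b]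

/-- The channel that prepares a maximally entangled state of two copies of `ℂ^b` and outputs one
copy, next to the register `ℂ^c ≃ ℂ^b ⊗ ℂ^a` holding the other copy and the input. Its Choi
operator is pure, which makes the local action of a supermap on it carry the full `superChoi`. -/
noncomputable def entangle (f : b × a ≃ c) : OpMap (a × Fin 1) (b × c) :=
  (Fintype.card b : ℂ)⁻¹ • conjBy (entangleKraus f)

theorem isChannel_entangle [Fintype c] [Nonempty b] (f : b × a ≃ c) : IsChannel (entangle f) := by
  classical
  have h_card : (Fintype.card b : ℂ) ≠ 0 := Nat.cast_ne_zero.mpr Fintype.card_ne_zero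
  constructor
  · rw [isCP_iff_posSemidef_choi, entangle, choi_smul]
    exact (isCP_conjBy _).posSemidef_choi.smul (inv_nonneg.mpr (Nat.cast_nonneg _))
  · intro X
    rw [entangle, LinearMap.smul_apply, conjBy, sandwich_apply, Matrix.trace_smul,
      Matrix.trace_mul_comm, ← Matrix.mul_assoc, conjTranspose_mul_entangleKraus,
      Matrix.smul_mul, Matrix.one_mul, Matrix.trace_smul, smul_smul, inv_mul_cancel₀ h_card,
      one_smul]

theorem component_entangle [DecidableEq a] [DecidableEq b] (f : b × a ≃ c) (κ κ' : b × a) :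
    component (entangle f) 0 0 (f κ) (f κ') = (Fintype.card b : ℂ)⁻¹ •
      sandwich (Matrix.single κ.1 κ.2 1) (Matrix.single κ'.1 κ'.2 1) := by
  refine LinearMap.ext fun X => ?_
  ext i j
  change (Fintype.card b : ℂ)⁻¹ *
    conjBy (entangleKraus f) (X ⊗ₖ Matrix.single 0 0 1) (i, f κ) (j, f κ') = _
  rw [conjBy_entangleKraus_kronecker]
  simp [sandwich_apply, Matrix.single_apply, ite_and]

theorem reduced_entangle [DecidableEq a] [DecidableEq b] [Fintype c] (f : b × a ≃ c)
    {σ : Matrix (Fin 1) (Fin 1) ℂ} (hσ : σ.trace = 1) :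
    reduced (entangle f) σ = depolarizing a b := by
  have hσ₀ : σ 0 0 = 1 := by simpa [Matrix.trace] using hσ
  refine LinearMap.ext fun X => ?_
  ext i j
  change ∑ k, (Fintype.card b : ℂ)⁻¹ * conjBy (entangleKraus f) (X ⊗ₖ σ) (i, k) (j, k) = _
  rw [← Equiv.sum_comp f, ← Finset.mul_sum]
  simp [conjBy_entangleKraus_kronecker, hσ₀, Fintype.sum_prod_type, ite_and, depolarizing,
    measurePrepare_apply, Matrix.one_apply, Matrix.trace]

end EntanglingChannel

section Supermaps

variable {a b : Type} [Fintype a] {Ai Ao Bi Bo Ci Co : Type}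
  [Fintype Ai] [DecidableEq Ai] [Fintype Ao] [DecidableEq Ao]
  [Fintype Bi] [DecidableEq Bi] [Fintype Bo] [DecidableEq Bo]
  [Fintype Ci] [DecidableEq Ci] [Fintype Co]

theorem IsSupermap.posSemidef_superChoi [Nonempty Ao] [Nonempty Bo]
    {S : OpMap (Ai × Bi) (Ao × Bo) →ₗ[ℂ] OpMap Ci Co} (hS : IsSupermap S) :
    (superChoi S).PosSemidef := by
  classical
  have h_card : (Fintype.card (Ao × Bo) : ℂ) ≠ 0 := Nat.cast_ne_zero.mpr Fintype.card_ne_zero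
  let f := Fintype.equivFin ((Ao × Bo) × (Ai × Bi))
  have h_reduced (σ) (hσ : IsDensity σ) : IsNoSignalling (reduced (entangle f) σ) := by
    rw [reduced_entangle f hσ.2, depolarizing_prod]
    exact isNoSignalling_tensorMap isChannel_depolarizing isChannel_depolarizing
  have h_choi := (hS.2 1 _ _ (isChannel_entangle f) h_reduced).1.posSemidef_choi
  have h_eq : superChoi S = (Fintype.card (Ao × Bo) : ℂ) •
      (choi (localAction S (entangle f))).submatrix
        (fun x => ((x.2.2, f (x.1.1, x.2.1)), (x.1.2, 0)))
        (fun x => ((x.2.2, f (x.1.1, x.2.1)), (x.1.2, 0))) := by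
    ext x y
    rw [Matrix.smul_apply, Matrix.submatrix_apply, choi_apply, localAction_apply]
    simp [component_entangle, block_single, superChoi, h_card, -Fintype.card_prod]
  rw [h_eq]
  exact (h_choi.submatrix _).smul (Nat.cast_nonneg _)

/-- The map `ℂ^a ⊗ ℂ^m → ℂ^b ⊗ ℂ` whose Choi operator is `N`, up to the order of the factors. -/
def slotMap {m : ℕ} (N : Matrix ((b × Fin m) × a) ((b × Fin m) × a) ℂ) :
    OpMap (a × Fin m) (b × Fin 1) where
  toFun X := Matrix.of fun p q => ∑ u, ∑ v, X u v * N ((p.1, u.2), u.1) ((q.1, v.2), v.1)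
  map_add' X Y := by
    ext p q
    simp [add_mul, Finset.sum_add_distrib]
  map_smul' r X := by
    ext p q
    simp [Finset.mul_sum, mul_assoc]

theorem slotMap_apply {m : ℕ} (N : Matrix ((b × Fin m) × a) ((b × Fin m) × a) ℂ)
    (X : Matrix (a × Fin m) (a × Fin m) ℂ) (p q : b × Fin 1) : slotMap N X p q =
      ∑ u, ∑ v, X u v * N ((p.1, u.2), u.1) ((q.1, v.2), v.1) := rfl

theorem choi_slotMap [DecidableEq a] {m : ℕ} (N : Matrix ((b × Fin m) × a) ((b × Fin m) × a) ℂ) :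
    choi (slotMap N) = N.submatrix (fun p => ((p.1.1, p.2.2), p.2.1))
      (fun p => ((p.1.1, p.2.2), p.2.1)) := by
  ext p q
  simp [choi_apply, slotMap_apply, Matrix.single_apply, ite_and]

theorem choi_component_slotMap [DecidableEq a] {m : ℕ}
    (N : Matrix ((b × Fin m) × a) ((b × Fin m) × a) ℂ) (k l : Fin m) (p q : b × a) :
    choi (component (slotMap N) k l 0 0) p q = N ((p.1, k), p.2) ((q.1, l), q.2) := by
  change slotMap N (Matrix.single p.2 q.2 1 ⊗ₖ Matrix.single k l 1) (p.1, 0) (q.1, 0) = _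
  simp [Matrix.single_kronecker_single, slotMap_apply, Matrix.single_apply, ite_and]

theorem isChannel_slotMap [DecidableEq a] [Fintype b] {m : ℕ}
    {N : Matrix ((b × Fin m) × a) ((b × Fin m) × a) ℂ} (hN : N.PosSemidef)
    (hN₁ : ∀ k l α α', ∑ i, N ((i, k), α) ((i, l), α') = if k = l ∧ α = α' then 1 else 0) :
    IsChannel (slotMap N) := by
  constructor
  · rw [isCP_iff_posSemidef_choi, choi_slotMap]
    exact hN.submatrix _
  · intro X
    calc (slotMap N X).trace
        = ∑ u, ∑ v, X u v * ∑ i, N ((i, u.2), u.1) ((i, v.2), v.1) := by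
          simp only [Matrix.trace, Matrix.diag_apply, slotMap_apply, Finset.mul_sum,
            Fintype.sum_prod_type (α₂ := Fin 1), Finset.univ_unique, Finset.sum_singleton]
          rw [Finset.sum_comm]
          exact Finset.sum_congr rfl fun u _ => Finset.sum_comm
      _ = X.trace := by
          simp [hN₁, Matrix.trace, Fintype.sum_prod_type, ite_and]

/-- Evaluated on a maximally entangled input, trace preservation of the local action fixes the
value of the linear functional that `N` defines on the Choi operator of `S`. -/
theorem IsSupermap.sum_superChoi {m : ℕ}
    {S : OpMap (Ai × Bi) (Ao × Bo) →ₗ[ℂ] OpMap (Fin m) Co} (hS : IsSupermap S)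
    {N : Matrix (((Ao × Bo) × Fin m) × (Ai × Bi)) (((Ao × Bo) × Fin m) × (Ai × Bi)) ℂ}
    (hN : IsChannel (slotMap N))
    (h_reduced : ∀ σ, IsDensity σ → IsNoSignalling (reduced (slotMap N) σ)) :
    ∑ u, ∑ v, ∑ i, N u v * superChoi S (u.1, (u.2, i)) (v.1, (v.2, i)) = m := by
  let Ω : Matrix (Fin m × Fin m) (Fin m × Fin m) ℂ := maxEntangled (Equiv.refl (Fin m))
  have h_sum_prod (F : ((Ao × Bo) × Fin m) × (Ai × Bi) → ℂ) :
      ∑ u, F u = ∑ k, ∑ p : (Ao × Bo) × (Ai × Bi), F ((p.1, k), p.2) := by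
    simp only [Fintype.sum_prod_type]
    exact (Finset.sum_congr rfl fun _ _ => Finset.sum_comm).trans Finset.sum_comm
  calc ∑ u, ∑ v, ∑ i, N u v * superChoi S (u.1, (u.2, i)) (v.1, (v.2, i))
      = ∑ i, ∑ k, ∑ l, S (component (slotMap N) k l 0 0) (Matrix.single k l 1) i i := by
        simp only [supermap_apply_single, choi_component_slotMap, h_sum_prod]
        simp only [Finset.sum_comm (s := Finset.univ (α := Fin m)) (t := Finset.univ (α := Co)),
          Finset.sum_comm (s := Finset.univ (α := (Ao × Bo) × (Ai × Bi)))
            (t := Finset.univ (α := Co)),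
          Finset.sum_comm (s := Finset.univ (α := (Ao × Bo) × (Ai × Bi)))
            (t := Finset.univ (α := Fin m))]
    _ = (localAction S (slotMap N) Ω).trace := by
        have h_block (k l : Fin m) : block k l Ω = Matrix.single k l 1 :=
          block_maxEntangled (Equiv.refl (Fin m)) k l
        simp [Matrix.trace, localAction_apply, Fintype.sum_prod_type, h_block]
    _ = m := by
        rw [(hS.2 m 1 (slotMap N) hN h_reduced).2, trace_maxEntangled, Fintype.card_fin]

end Supermaps

section ChannelSpan

variable {a b : Type}

/-- The Hermitian-preserving part `X ↦ (Φ(X) + Φ(X†)†) / 2`; its Choi operator is the Hermitian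
part of that of `Φ`. -/
noncomputable def hermPart (Φ : OpMap a b) : OpMap a b where
  toFun X := (2 : ℂ)⁻¹ • (Φ X + (Φ Xᴴ)ᴴ)
  map_add' X Y := by
    simp only [Matrix.conjTranspose_add, map_add, smul_add]
    abel
  map_smul' r X := by simp [Matrix.conjTranspose_smul, smul_comm r]

theorem hermPart_apply (Φ : OpMap a b) (X : Matrix a a ℂ) :
    hermPart Φ X = (2 : ℂ)⁻¹ • (Φ X + (Φ Xᴴ)ᴴ) := rfl

theorem choi_hermPart [DecidableEq a] (Φ : OpMap a b) :
    choi (hermPart Φ) = (2 : ℂ)⁻¹ • (choi Φ + (choi Φ)ᴴ) := by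
  ext p q
  simp [choi_apply, hermPart_apply]

theorem hermPart_add_I_smul_hermPart (Φ : OpMap a b) :
    hermPart Φ + Complex.I • hermPart (-Complex.I • Φ) = Φ := by
  refine LinearMap.ext fun X => ?_
  have h_I : Complex.I • (2 : ℂ)⁻¹ • (-Complex.I • Φ X + (-Complex.I • Φ Xᴴ)ᴴ) =
      (2 : ℂ)⁻¹ • (Φ X - (Φ Xᴴ)ᴴ) := by
    rw [Matrix.conjTranspose_smul, smul_comm Complex.I, smul_add, smul_smul, smul_smul]
    simp [← sub_eq_add_neg]
  rw [LinearMap.add_apply, LinearMap.smul_apply, hermPart_apply, hermPart_apply,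
    LinearMap.smul_apply, LinearMap.smul_apply, h_I, ← smul_add, add_add_sub_cancel, ← two_smul ℂ,
    inv_smul_smul₀ two_ne_zero]

theorem trace_hermPart [Fintype a] [Fintype b] {Φ : OpMap a b} {t : ℂ}
    (h_trace : ∀ X, (Φ X).trace = t * X.trace) (X : Matrix a a ℂ) :
    (hermPart Φ X).trace = t.re * X.trace := by
  rw [hermPart_apply, Matrix.trace_smul, Matrix.trace_add, Matrix.trace_conjTranspose, h_trace,
    h_trace, Matrix.trace_conjTranspose, star_mul', star_star, Complex.re_eq_add_conj, smul_eq_mul,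
    starRingEnd_apply]
  ring

variable [Fintype a] [DecidableEq a]

omit [Fintype a] in
open scoped Matrix.Norms.L2Operator MatrixOrder in
theorem eventually_posSemidef_add_smul_one [Finite a] {H : Matrix a a ℂ} (hH : H.IsHermitian) :
    ∀ᶠ r : ℝ in Filter.atTop, (H + (r : ℂ) • 1).PosSemidef := by
  have := Fintype.ofFinite a
  filter_upwards [Filter.eventually_ge_atTop ‖H‖] with r hr
  have h_neg : -algebraMap ℝ (Matrix a a ℂ) ‖H‖ ≤ H :=
    (show IsSelfAdjoint H from hH).neg_algebraMap_norm_le_self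
  have h_mono : algebraMap ℝ (Matrix a a ℂ) ‖H‖ ≤ algebraMap ℝ (Matrix a a ℂ) r :=
    algebraMap_mono _ hr
  have h_smul : (r : ℂ) • (1 : Matrix a a ℂ) = algebraMap ℝ (Matrix a a ℂ) r := by
    rw [Algebra.algebraMap_eq_smul_one, Complex.coe_smul]
  rw [h_smul, ← Matrix.nonneg_iff_posSemidef, ← neg_le_iff_add_nonneg]
  exact (neg_le_neg h_mono).trans h_neg

variable [Fintype b]

variable (a b) in
/-- The complex span of the channels. -/
def channelSpan : Submodule ℂ (OpMap a b) :=
  Submodule.span ℂ {Ψ | IsChannel Ψ}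

omit [DecidableEq a] in
theorem mem_channelSpan_of_isCP {Φ : OpMap a b} (hΦ : IsCP Φ) {t : ℝ} (ht : 0 < t)
    (h_trace : ∀ X, (Φ X).trace = t * X.trace) : Φ ∈ channelSpan a b := by
  classical
  have ht' : (t : ℂ) ≠ 0 := Complex.ofReal_ne_zero.mpr ht.ne'
  have h_channel : IsChannel ((t : ℂ)⁻¹ • Φ) := by
    constructor
    · rw [isCP_iff_posSemidef_choi, choi_smul]
      exact hΦ.posSemidef_choi.smul (inv_nonneg.mpr (Complex.zero_le_real.mpr ht.le))
    · intro X
      rw [LinearMap.smul_apply, Matrix.trace_smul, h_trace, smul_eq_mul, inv_mul_cancel_left₀ ht']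
  rw [← smul_inv_smul₀ ht' Φ]
  exact Submodule.smul_mem _ _ (Submodule.subset_span h_channel)

theorem mem_channelSpan_of_isHermitian [Nonempty b] {Φ : OpMap a b} (hΦ : (choi Φ).IsHermitian)
    {t : ℝ} (h_trace : ∀ X, (Φ X).trace = t * X.trace) : Φ ∈ channelSpan a b := by
  classical
  have h_card : (0 : ℝ) < Fintype.card b := Nat.cast_pos.mpr Fintype.card_pos
  obtain ⟨r, hr, hrt⟩ := ((eventually_posSemidef_add_smul_one hΦ).and
    (Filter.eventually_gt_atTop (-t / Fintype.card b))).exists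
  rw [div_lt_iff₀ h_card] at hrt
  have h_choi : choi (Φ + ((r * Fintype.card b : ℝ) : ℂ) • depolarizing a b) =
      choi Φ + (r : ℂ) • 1 := by
    rw [choi_add, choi_smul, depolarizing, choi_measurePrepare, Matrix.transpose_one,
      Matrix.smul_kronecker, Matrix.one_kronecker_one, smul_smul]
    simp
  have h_sum : Φ + ((r * Fintype.card b : ℝ) : ℂ) • depolarizing a b ∈ channelSpan a b := by
    refine mem_channelSpan_of_isCP (t := t + r * Fintype.card b)
      (isCP_iff_posSemidef_choi.mpr (h_choi ▸ hr)) (by linarith) fun X => ?_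
    simp [h_trace, isChannel_depolarizing.2, add_mul]
  exact (Submodule.add_mem_iff_left (channelSpan a b) (Submodule.smul_mem _ _
    (Submodule.subset_span isChannel_depolarizing))).mp h_sum

omit [DecidableEq a] in
theorem mem_channelSpan [Nonempty b] {Φ : OpMap a b} {t : ℂ}
    (h_trace : ∀ X, (Φ X).trace = t * X.trace) : Φ ∈ channelSpan a b := by
  classical
  have h_herm (Ψ : OpMap a b) : (choi (hermPart Ψ)).IsHermitian := by
    rw [choi_hermPart]
    simp [Matrix.IsHermitian, add_comm]
  rw [← hermPart_add_I_smul_hermPart Φ]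
  refine Submodule.add_mem _ (mem_channelSpan_of_isHermitian (h_herm Φ) (trace_hermPart h_trace))
    (Submodule.smul_mem _ _ (mem_channelSpan_of_isHermitian (h_herm _)
      (trace_hermPart (t := -Complex.I * t) fun X => ?_)))
  rw [LinearMap.smul_apply, Matrix.trace_smul, h_trace, smul_eq_mul, mul_assoc]

end ChannelSpan

section ProductSpan

variable {a b c e : Type} [Fintype a] [DecidableEq a] [Fintype b] [Fintype c] [DecidableEq c]
  [Fintype e]

variable (a b c e) in
/-- The tensor product of maps as a bilinear function. -/
def tensorMapBilin : OpMap a b →ₗ[ℂ] OpMap c e →ₗ[ℂ] OpMap (a × c) (b × e) :=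
  LinearMap.mk₂ ℂ tensorMap
    (fun _ _ _ => choi_injective (by simp [choi_tensorMap, choi_add, Matrix.add_kronecker]; rfl))
    (fun _ _ _ => choi_injective (by simp [choi_tensorMap, choi_smul, Matrix.smul_kronecker]; rfl))
    (fun _ _ _ => choi_injective (by simp [choi_tensorMap, choi_add, Matrix.kronecker_add]; rfl))
    (fun _ _ _ => choi_injective (by simp [choi_tensorMap, choi_smul, Matrix.kronecker_smul]; rfl))

variable (a b c e) in
/-- The complex span of the products of channels. -/
def productSpan : Submodule ℂ (OpMap (a × c) (b × e)) :=
  Submodule.map₂ (tensorMapBilin a b c e) (channelSpan a b) (channelSpan c e)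

theorem tensorMap_mem_productSpan {Φ : OpMap a b} {Ψ : OpMap c e} (hΦ : Φ ∈ channelSpan a b)
    (hΨ : Ψ ∈ channelSpan c e) : tensorMap Φ Ψ ∈ productSpan a b c e :=
  Submodule.apply_mem_map₂ (tensorMapBilin a b c e) hΦ hΨ

/-- Replacing the complex coefficients by their real parts preserves the Hermitian Choi operator
of a channel. -/
theorem isNoSignalling_of_mem_productSpan {N : OpMap (a × c) (b × e)} (hN : IsChannel N)
    (h : N ∈ productSpan a b c e) : IsNoSignalling N := by
  refine ⟨hN, ?_⟩
  rw [productSpan, channelSpan, channelSpan, Submodule.map₂_span_span] at h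
  obtain ⟨r, z, T, hT⟩ := Submodule.mem_span_set'.mp h
  choose A hA B hB hAB using fun j => (T j).2
  refine ⟨r, fun j => (z j).re, A, B, hA, hB, choi_injective ?_⟩
  have h_choi : choi N = ∑ j, z j • choi (tensorMap (A j) (B j)) := by
    rw [← hT, choi_sum]
    exact Finset.sum_congr rfl fun j _ => by rw [← hAB]; rfl
  have h_selfAdjoint (j) : IsSelfAdjoint (choi (tensorMap (A j) (B j))) :=
    (isChannel_tensorMap (hA j) (hB j)).1.posSemidef_choi.isHermitian
  have h_re (j) : (realPart (z j • choi (tensorMap (A j) (B j))) : Matrix _ _ ℂ) =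
      ((z j).re : ℂ) • choi (tensorMap (A j) (B j)) := by
    rw [realPart_smul, (h_selfAdjoint j).imaginaryPart, smul_zero, sub_zero,
      selfAdjoint.val_smul, (h_selfAdjoint j).coe_realPart, Complex.coe_smul]
  rw [← (show IsSelfAdjoint (choi N) from hN.1.posSemidef_choi.isHermitian).coe_realPart, h_choi,
    map_sum, AddSubgroup.val_finsetSum, choi_sum]
  exact Finset.sum_congr rfl fun j _ => h_re j

theorem measurePrepare_one_mem_productSpan [Nonempty b] [Nonempty e]
    (Y : Matrix (b × e) (b × e) ℂ) : measurePrepare 1 Y ∈ productSpan a b c e := by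
  classical
  have h_mem {a b : Type} [Fintype a] [DecidableEq a] [Fintype b] [Nonempty b]
      (Y : Matrix b b ℂ) : measurePrepare 1 Y ∈ channelSpan a b :=
    mem_channelSpan (t := Y.trace) fun X => by simp [measurePrepare_apply, mul_comm]
  rw [Matrix.matrix_eq_sum_single Y]
  simp only [map_sum]
  refine Submodule.sum_mem _ fun p _ => Submodule.sum_mem _ fun q _ => ?_
  have h_single : Matrix.single p q (Y p q) =
      Matrix.single p.1 q.1 (Y p q) ⊗ₖ Matrix.single p.2 q.2 (1 : ℂ) := by
    rw [Matrix.single_kronecker_single, mul_one]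
  rw [h_single, ← Matrix.one_kronecker_one, ← tensorMap_measurePrepare]
  exact tensorMap_mem_productSpan (h_mem _) (h_mem _)

theorem swapOp_eq_sum : swapOp a =
    ∑ i, ∑ j, Matrix.single i j (1 : ℂ) ⊗ₖ Matrix.single j i (1 : ℂ) := by
  ext p q
  simp [swapOp_apply, Matrix.sum_apply, Matrix.single_apply, ite_and, eq_comm (a := p.1)]

/-- The matrix unit `|i⟩⟨j|` minus its trace part. -/
noncomputable def tracelessUnit (i j : a) : Matrix a a ℂ :=
  Matrix.single i j 1 - ((if i = j then 1 else 0) * (Fintype.card a : ℂ)⁻¹) • 1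

theorem trace_tracelessUnit [Nonempty a] (i j : a) : (tracelessUnit i j).trace = 0 := by
  have h_card : (Fintype.card a : ℂ) ≠ 0 := Nat.cast_ne_zero.mpr Fintype.card_ne_zero
  rcases eq_or_ne i j with rfl | h
  · simp [tracelessUnit, h_card]
  · simp [tracelessUnit, h, Matrix.trace_single_eq_of_ne]

theorem swapOp_sub_eq_sum [Nonempty a] : swapOp a - (Fintype.card a : ℂ)⁻¹ • 1 =
    ∑ i : a, ∑ j : a, tracelessUnit i j ⊗ₖ tracelessUnit j i := by
  have h_card : (Fintype.card a : ℂ) ≠ 0 := Nat.cast_ne_zero.mpr Fintype.card_ne_zero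
  have h_diag (x y : a) :
      ∑ i, Matrix.single i i (1 : ℂ) x y = (1 : Matrix a a ℂ) x y := by
    rw [← Matrix.sum_apply, Matrix.sum_single_one]
  have h_one (p q : a × a) : (1 : Matrix (a × a) (a × a) ℂ) p q =
      (1 : Matrix a a ℂ) p.1 q.1 * (1 : Matrix a a ℂ) p.2 q.2 := by
    rw [← Matrix.one_kronecker_one, Matrix.kroneckerMap_apply]
  rw [swapOp_eq_sum]
  ext p q
  simp only [tracelessUnit, Matrix.sub_apply, Matrix.sum_apply, Matrix.kroneckerMap_apply,
    Matrix.smul_apply, smul_eq_mul, sub_mul, mul_sub, Finset.sum_sub_distrib, ite_mul, mul_ite,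
    one_mul, zero_mul, mul_zero, Finset.sum_ite_eq, Finset.sum_ite_eq',
    Finset.mem_univ, if_true]
  simp only [← Finset.sum_mul, ← Finset.mul_sum, h_diag, h_one, Finset.sum_const,
    Finset.card_univ, nsmul_eq_mul]
  field_simp
  ring

theorem measurePrepare_swapOp_mem_productSpan [Nonempty a] :
    measurePrepare (swapOp a) (swapOp a - (Fintype.card a : ℂ)⁻¹ • 1) ∈ productSpan a a a a := by
  have h_mem (i j k l : a) :
      measurePrepare (Matrix.single i j 1) (tracelessUnit k l) ∈ channelSpan a a :=
    mem_channelSpan (t := 0) fun X => by simp [measurePrepare_apply, trace_tracelessUnit]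
  rw [swapOp_sub_eq_sum]
  conv in (measurePrepare (swapOp a) _) => rw [swapOp_eq_sum]
  simp only [map_sum, LinearMap.sum_apply]
  refine Submodule.sum_mem _ fun i _ => Submodule.sum_mem _ fun j _ =>
    Submodule.sum_mem _ fun k _ => Submodule.sum_mem _ fun l _ => ?_
  rw [← tensorMap_measurePrepare]
  exact tensorMap_mem_productSpan (h_mem k l i j) (h_mem l k j i)

end ProductSpan

section PartialTrace

variable {m n R : Type*} [Fintype m] [CommSemiring R]

/-- The partial trace of an operator on a tensor product over the first factor. -/
def partialTrace : Matrix (m × n) (m × n) R →ₗ[R] Matrix n n R where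
  toFun X := Matrix.of fun k l => ∑ i, X (i, k) (i, l)
  map_add' X Y := by
    ext k l
    simp [Finset.sum_add_distrib]
  map_smul' r X := by
    ext k l
    simp [Finset.mul_sum]

theorem partialTrace_apply (X : Matrix (m × n) (m × n) R) (k l : n) :
    partialTrace X k l = ∑ i, X (i, k) (i, l) := rfl

theorem partialTrace_kronecker (X : Matrix m m R) (Y : Matrix n n R) :
    partialTrace (X ⊗ₖ Y) = X.trace • Y := by
  ext k l
  simp [partialTrace_apply, Matrix.trace, Finset.sum_mul]

theorem partialTrace_kronecker_one_mul [Fintype n] [DecidableEq n] (A : Matrix m m R)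
    (X : Matrix (m × n) (m × n) R) :
    partialTrace ((A ⊗ₖ 1) * X) = partialTrace (X * (A ⊗ₖ 1)) := by
  ext k l
  simp only [partialTrace_apply, Matrix.mul_apply, Fintype.sum_prod_type, kroneckerMap_apply,
    Matrix.one_apply, mul_ite, mul_one, mul_zero, ite_mul, zero_mul, Finset.sum_ite_eq,
    Finset.sum_ite_eq', Finset.mem_univ, if_true]
  rw [Finset.sum_comm]
  simp only [mul_comm]

variable {a : Type*} [Fintype a] [DecidableEq a]

theorem partialTrace_swap₁₂ : partialTrace (swap₁₂ a) = (Fintype.card a : ℂ) • 1 := by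
  rw [swap₁₂, partialTrace_kronecker, trace_swapOp]

theorem partialTrace_symProj (ε : ℤˣ) : partialTrace (symProj a ε) =
    ((Fintype.card a : ℂ) * (Fintype.card a + ((ε : ℤ) : ℂ)) / 2) • 1 := by
  have h_one : partialTrace (1 : Matrix ((a × a) × a) ((a × a) × a) ℂ) =
      (Fintype.card a : ℂ) ^ 2 • 1 := by
    rw [← Matrix.one_kronecker_one, partialTrace_kronecker, Matrix.trace_one, Fintype.card_prod,
      Nat.cast_mul, sq]
  rw [symProj, map_smul, map_add, map_smul, h_one, partialTrace_swap₁₂]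
  module

theorem partialTrace_pairEmb_mul_transpose :
    partialTrace (pairEmb a * (pairEmb a)ᵀ) = (Fintype.card a : ℂ) • 1 := by
  ext k l
  rcases eq_or_ne k l with rfl | h_ne <;>
    simp [partialTrace_apply, Matrix.mul_apply, pairEmb, Fintype.sum_prod_type, ite_and, *,
      Ne.symm]

theorem partialTrace_swap₁₂_mul_pairEmb_mul_transpose :
    partialTrace (swap₁₂ a * (pairEmb a * (pairEmb a)ᵀ)) = 1 := by
  rw [← Matrix.mul_assoc, swap₁₂_mul_pairEmb]
  ext k l
  simp [partialTrace_apply, Matrix.mul_apply, pairEmb, Fintype.sum_prod_type, ite_and,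
    Matrix.one_apply, eq_comm]

theorem partialTrace_symUnit_self (ε : ℤˣ) : partialTrace (symUnit a ε ε) =
    ((Fintype.card a + ((ε : ℤ) : ℂ)) / 2) • 1 := by
  have h_kronecker : symProj a ε =
      ((2 : ℂ)⁻¹ • (1 + ((ε : ℤ) : ℂ) • swapOp a)) ⊗ₖ 1 := by
    rw [symProj, swap₁₂, smul_kronecker, add_kronecker, smul_kronecker, one_kronecker_one]
  calc partialTrace (symUnit a ε ε)
      = partialTrace (symProj a ε * (pairEmb a * (pairEmb a)ᵀ) * symProj a ε) := by
        rw [symUnit, symEmb, transpose_mul, transpose_symProj]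
        simp only [Matrix.mul_assoc]
    _ = partialTrace (symProj a ε * (pairEmb a * (pairEmb a)ᵀ)) := by
        conv_lhs => rw [h_kronecker, ← partialTrace_kronecker_one_mul, ← h_kronecker]
        rw [← Matrix.mul_assoc, symProj_mul_symProj, if_pos rfl]
    _ = ((Fintype.card a + ((ε : ℤ) : ℂ)) / 2) • 1 := by
        rw [symProj, Matrix.smul_mul, Matrix.add_mul, Matrix.one_mul, Matrix.smul_mul, map_smul,
          map_add, map_smul, partialTrace_pairEmb_mul_transpose,
          partialTrace_swap₁₂_mul_pairEmb_mul_transpose]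
        module

variable [Nontrivial a]

theorem partialTrace_embProj (ε : ℤˣ) : partialTrace (embProj a ε) = 1 := by
  rw [embProj, map_smul, partialTrace_symUnit_self, smul_smul,
    div_mul_div_cancel₀ (card_add_sign_ne_zero a ε), div_self two_ne_zero, one_smul]

theorem partialTrace_tracelessProj (ε : ℤˣ) : partialTrace (tracelessProj a ε) =
    ((tracelessProj a ε).trace / Fintype.card a) • 1 := by
  have h_card : (Fintype.card a : ℂ) ≠ 0 := Nat.cast_ne_zero.mpr Fintype.card_ne_zero
  rw [trace_tracelessProj, tracelessProj, map_sub, partialTrace_symProj, partialTrace_embProj,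
    ← one_smul ℂ (1 : Matrix a a ℂ), smul_smul, ← sub_smul, smul_smul, mul_one, mul_one]
  congr 1
  field_simp

end PartialTrace

section SwapFamily

variable {a b : Type} {m : ℕ}

theorem choi_reduced_slotMap [Fintype a] [DecidableEq a]
    (N : Matrix ((b × Fin m) × a) ((b × Fin m) × a) ℂ) (σ : Matrix (Fin m) (Fin m) ℂ)
    (p q : b × a) : choi (reduced (slotMap N) σ) p q =
      ∑ k, ∑ l, σ k l * N ((p.1, k), p.2) ((q.1, l), q.2) := by
  change ∑ k : Fin 1, slotMap N (Matrix.single p.2 q.2 1 ⊗ₖ σ) (p.1, k) (q.1, k) = _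
  simp [slotMap_apply, Fintype.sum_prod_type, Matrix.single_apply, ite_and]

theorem IsSupermap.trace_superChoi_mul {Ai Ao Bi Bo Co : Type}
    [Fintype Ai] [DecidableEq Ai] [Fintype Ao] [DecidableEq Ao]
    [Fintype Bi] [DecidableEq Bi] [Fintype Bo] [DecidableEq Bo] [Fintype Co] [DecidableEq Co]
    {S : OpMap (Ai × Bi) (Ao × Bo) →ₗ[ℂ] OpMap (Fin m) Co} (hS : IsSupermap S)
    {N : Matrix (((Ao × Bo) × Fin m) × (Ai × Bi)) (((Ao × Bo) × Fin m) × (Ai × Bi)) ℂ}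
    (hN : IsChannel (slotMap N))
    (h_reduced : ∀ σ, IsDensity σ → IsNoSignalling (reduced (slotMap N) σ)) :
    (superChoi S * (Nᵀ ⊗ₖ (1 : Matrix Co Co ℂ)).submatrix
      (Equiv.prodAssoc ((Ao × Bo) × Fin m) (Ai × Bi) Co).symm
      (Equiv.prodAssoc ((Ao × Bo) × Fin m) (Ai × Bi) Co).symm).trace = m := by
  have h_sum (F : ((Ao × Bo) × Fin m) × ((Ai × Bi) × Co) → ℂ) :
      ∑ x, F x = ∑ u : ((Ao × Bo) × Fin m) × (Ai × Bi), ∑ i, F (u.1, (u.2, i)) := by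
    rw [← Equiv.sum_comp (Equiv.prodAssoc _ _ _), Fintype.sum_prod_type]
    rfl
  rw [← hS.sum_superChoi hN h_reduced, Matrix.trace, h_sum]
  simp only [Matrix.diag_apply, Matrix.mul_apply, h_sum]
  refine Finset.sum_congr rfl fun u _ => ?_
  rw [Finset.sum_comm]
  simp [Matrix.one_apply, mul_comm]

variable [Fintype a] [DecidableEq a]

/-- Choi operators of a family of two-slot no-signalling maps controlled by a third input, the
feasible points of the dual of the optimisation over supermaps. -/
noncomputable def swapFamily (G : Matrix ((a × a) × Fin m) ((a × a) × Fin m) ℂ) (β : ℂ) :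
    Matrix (((a × a) × Fin m) × (a × a)) (((a × a) × Fin m) × (a × a)) ℂ :=
  G ⊗ₖ 1 + β • (((swapOp a - (Fintype.card a : ℂ)⁻¹ • 1) ⊗ₖ 1) ⊗ₖ swapOp a)

variable {G : Matrix ((a × a) × Fin m) ((a × a) × Fin m) ℂ} {β : ℂ}

theorem transpose_swapFamily (hG : Gᵀ = G) : (swapFamily G β)ᵀ = swapFamily G β := by
  simp only [swapFamily, Matrix.transpose_add, Matrix.transpose_smul,
    ← Matrix.kroneckerMap_transpose, hG, Matrix.transpose_one, Matrix.transpose_sub,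
    transpose_swapOp]

variable [Nonempty a]

theorem isChannel_slotMap_swapFamily (hN : (swapFamily G β).PosSemidef)
    (hG : partialTrace G = 1) : IsChannel (slotMap (swapFamily G β)) := by
  have h_trace : (swapOp a - (Fintype.card a : ℂ)⁻¹ • 1).trace = 0 := by
    rw [Matrix.trace_sub, trace_swapOp, Matrix.trace_smul, Matrix.trace_one, Fintype.card_prod]
    simp
  refine isChannel_slotMap hN fun k l α α' => ?_
  calc ∑ i, swapFamily G β ((i, k), α) ((i, l), α')
      = partialTrace G k l * (1 : Matrix (a × a) (a × a) ℂ) α α' +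
        β * (partialTrace ((swapOp a - (Fintype.card a : ℂ)⁻¹ • 1) ⊗ₖ 1) k l *
          swapOp a α α') := by
        simp only [swapFamily, partialTrace_apply, Matrix.add_apply, Matrix.smul_apply,
          Matrix.kroneckerMap_apply, smul_eq_mul, Finset.sum_add_distrib, Finset.sum_mul,
          Finset.mul_sum]
    _ = if k = l ∧ α = α' then 1 else 0 := by
        rw [hG, partialTrace_kronecker, h_trace, zero_smul, Matrix.zero_apply, zero_mul,
          mul_zero, add_zero, Matrix.one_apply, Matrix.one_apply, ite_and, ite_mul, one_mul,
          zero_mul]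

theorem isNoSignalling_reduced_slotMap_swapFamily (hN : (swapFamily G β).PosSemidef)
    (hG : partialTrace G = 1) {σ : Matrix (Fin m) (Fin m) ℂ} (hσ : IsDensity σ) :
    IsNoSignalling (reduced (slotMap (swapFamily G β)) σ) := by
  have h_eq : reduced (slotMap (swapFamily G β)) σ =
      measurePrepare 1 (Matrix.of fun b b' => ∑ k, ∑ l, σ k l * G (b, k) (b', l)) +
        β • measurePrepare (swapOp a) (swapOp a - (Fintype.card a : ℂ)⁻¹ • 1) := by
    have hσ₁ : ∑ k, σ k k = 1 := hσ.2
    apply choi_injective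
    rw [choi_add, choi_smul, choi_measurePrepare, choi_measurePrepare, transpose_swapOp,
      Matrix.transpose_one]
    ext p q
    simp only [choi_reduced_slotMap, swapFamily, Matrix.add_apply, Matrix.smul_apply,
      Matrix.kroneckerMap_apply, smul_eq_mul, mul_add, Finset.sum_add_distrib, Matrix.of_apply,
      Finset.sum_mul, mul_assoc]
    congr 1
    simp only [Matrix.one_apply, ite_mul, one_mul, zero_mul, mul_ite, mul_zero, Finset.sum_ite_eq,
      Finset.mem_univ, if_true, ← Finset.sum_mul, hσ₁]
  refine isNoSignalling_of_mem_productSpan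
    (isChannel_reduced (isChannel_slotMap_swapFamily hN hG) hσ) ?_
  rw [h_eq]
  exact Submodule.add_mem _ (measurePrepare_one_mem_productSpan _)
    (Submodule.smul_mem _ _ measurePrepare_swapOp_mem_productSpan)

end SwapFamily

section Twirl

open scoped Matrix.Norms.L2Operator MatrixOrder

variable {G : Type*} [TopologicalSpace G]

theorem integrable_of_continuous [CompactSpace G] [MeasurableSpace G] [BorelSpace G]
    {μ : Measure G} [IsFiniteMeasure μ] {E : Type*} [NormedAddCommGroup E] {f : G → E}
    (hf : Continuous f) : Integrable f μ :=
  hf.integrable_of_hasCompactSupport (HasCompactSupport.of_compactSpace f)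

variable [Group G] {n : Type} [Fintype n] [DecidableEq n] (ρ : G →ₜ* unitaryGroup n ℂ)

theorem continuous_coe_rep : Continuous fun g => (ρ g).1 :=
  continuous_subtype_val.comp ρ.continuous_toFun

theorem continuous_choi_conjBy_rep : Continuous fun g => choi (conjBy (ρ g).1) := by
  refine continuous_matrix fun p q => ?_
  simp only [conjBy, choi_sandwich]
  exact ((continuous_coe_rep ρ).matrix_elem _ _).mul ((continuous_coe_rep ρ).matrix_elem _ _).star

variable [CompactSpace G] [MeasurableSpace G] [BorelSpace G] (μ : Measure G) [IsFiniteMeasure μ]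

theorem integrable_rep_mul_mul_conjTranspose (X : Matrix n n ℂ) :
    Integrable (fun g => (ρ g).1 * X * (ρ g).1ᴴ) μ :=
  integrable_of_continuous
    (((continuous_coe_rep ρ).mul continuous_const).mul (continuous_coe_rep ρ).star)

/-- The average of the conjugations by the unitaries of a representation. -/
noncomputable def twirl : OpMap n n where
  toFun X := ∫ g, (ρ g).1 * X * (ρ g).1ᴴ ∂μ
  map_add' X Y := by
    simp only [Matrix.mul_add, Matrix.add_mul]
    exact integral_add (integrable_rep_mul_mul_conjTranspose ρ μ X)
      (integrable_rep_mul_mul_conjTranspose ρ μ Y)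
  map_smul' r X := by
    simp only [Matrix.mul_smul, Matrix.smul_mul, integral_smul, RingHom.id_apply]

theorem map_twirl {E : Type*} [NormedAddCommGroup E] [NormedSpace ℂ E] [CompleteSpace E]
    (f : Matrix n n ℂ →ₗ[ℂ] E) (X : Matrix n n ℂ) :
    f (twirl ρ μ X) = ∫ g, f ((ρ g).1 * X * (ρ g).1ᴴ) ∂μ :=
  (f.toContinuousLinearMap.integral_comp_comm (integrable_rep_mul_mul_conjTranspose ρ μ X)).symm

theorem choi_twirl_apply (p q : n × n) :
    choi (twirl ρ μ) p q = ∫ g, (ρ g).1 p.1 p.2 * star ((ρ g).1 q.1 q.2) ∂μ := by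
  simp only [← choi_sandwich]
  exact map_twirl ρ μ (entryLinearMap ℂ ℂ p.1 q.1) (single p.2 q.2 1)

theorem choi_twirl : choi (twirl ρ μ) = ∫ g, choi (conjBy (ρ g).1) ∂μ := by
  ext p q
  have h_entry := (entryLinearMap ℂ ℂ p q).toContinuousLinearMap.integral_comp_comm
    (integrable_of_continuous (μ := μ) (continuous_choi_conjBy_rep ρ))
  refine (choi_twirl_apply ρ μ p q).trans (Eq.trans ?_ h_entry)
  simp only [← choi_sandwich]
  rfl

theorem isCP_twirl : IsCP (twirl ρ μ) := by
  rw [isCP_iff_posSemidef_choi, choi_twirl, ← Matrix.nonneg_iff_posSemidef]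
  exact integral_nonneg fun g => (isCP_conjBy _).posSemidef_choi.nonneg

theorem trace_mul_twirl [IsProbabilityMeasure μ] {Q : Matrix n n ℂ} (hQ : ∀ g, Commute Q (ρ g).1)
    (X : Matrix n n ℂ) : (Q * twirl ρ μ X).trace = (Q * X).trace := by
  have h_trace (g : G) : (Q * ((ρ g).1 * X * (ρ g).1ᴴ)).trace = (Q * X).trace := by
    rw [← Matrix.mul_assoc, ← Matrix.mul_assoc, (hQ g).eq, Matrix.trace_mul_comm,
      Matrix.mul_assoc, ← Matrix.mul_assoc, ← star_eq_conjTranspose, UnitaryGroup.star_mul_self,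
      Matrix.one_mul]
  have h_map := map_twirl ρ μ (traceLinearMap n ℂ ℂ ∘ₗ LinearMap.mulLeft ℂ Q) X
  simpa [h_trace] using h_map

theorem commute_twirl [ContinuousMul G] [μ.IsMulLeftInvariant] (X : Matrix n n ℂ) (h : G) :
    Commute (twirl ρ μ X) (ρ h).1 := by
  rw [commute_iff_mul_mul_conjTranspose (ρ h).2, ← sandwich_apply, map_twirl]
  calc ∫ g, sandwich (ρ h).1 (ρ h).1 ((ρ g).1 * X * (ρ g).1ᴴ) ∂μ
      = ∫ g, (ρ (h * g)).1 * X * (ρ (h * g)).1ᴴ ∂μ := by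
        simp only [sandwich_apply, map_mul, UnitaryGroup.mul_val, conjTranspose_mul,
          Matrix.mul_assoc]
    _ = twirl ρ μ X :=
        integral_mul_left_eq_self (fun g => (ρ g).1 * X * (ρ g).1ᴴ) h

end Twirl

section Moment

instance compactSpace_unitaryGroup {n : Type*} [Fintype n] [DecidableEq n] :
    CompactSpace (unitaryGroup n ℂ) := by
  refine isCompact_iff_compactSpace.mp ((isCompact_univ_pi fun _ => isCompact_univ_pi fun _ =>
    isCompact_closedBall (0 : ℂ) 1).of_isClosed_subset ?_ fun U hU i _ j _ => ?_)
  · have h_eq : (unitaryGroup n ℂ : Set (Matrix n n ℂ)) = {U | U * star U = 1} :=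
      Set.ext fun U => mem_unitaryGroup_iff
    rw [h_eq]
    exact isClosed_eq (by fun_prop) continuous_const
  · exact mem_closedBall_zero_iff.mpr (entry_norm_bound_of_unitary hU i j)

variable {a : Type} [Fintype a] [DecidableEq a]

variable (a) in
/-- The difference of the projections on the two copies of `ℂ^a`. Conjugation by it changes the
sign of the matrix units between the two copies. -/
noncomputable def embSign : Matrix ((a × a) × a) ((a × a) × a) ℂ :=
  embProj a 1 - embProj a (-1)

variable (a) in
/-- The sum of a twirl by `tripleRep` and of its conjugate by `embSign`. -/
noncomputable def momentMap : OpMap ((a × a) × a) ((a × a) × a) :=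
  ∑ ε : ℤˣ, ((tracelessProj a ε).trace⁻¹ • measurePrepare (tracelessProj a ε) (tracelessProj a ε) +
    (2 / Fintype.card a : ℂ) • measurePrepare (embProj a ε) (embProj a ε))

theorem momentMap_apply (X : Matrix ((a × a) × a) ((a × a) × a) ℂ) : momentMap a X =
    ∑ ε : ℤˣ, (((tracelessProj a ε).trace⁻¹ * (tracelessProj a ε * X).trace) • tracelessProj a ε +
      (2 / Fintype.card a * (embProj a ε * X).trace) • embProj a ε) := by
  simp only [momentMap, LinearMap.sum_apply, LinearMap.add_apply, LinearMap.smul_apply,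
    measurePrepare_apply, smul_smul]

theorem momentMap_twirl [MeasurableSpace (unitaryGroup a ℂ)] [BorelSpace (unitaryGroup a ℂ)]
    (μ : Measure (unitaryGroup a ℂ)) [IsProbabilityMeasure μ] [Nontrivial a]
    (X : Matrix ((a × a) × a) ((a × a) × a) ℂ) :
    momentMap a (twirl tripleRep μ X) = momentMap a X := by
  simp only [momentMap_apply,
    trace_mul_twirl tripleRep μ fun U => (commute_tripleRep_tracelessProj U _).symm,
    trace_mul_twirl tripleRep μ fun U => (commute_tripleRep_embProj U _).symm]

theorem conjTranspose_embSign : (embSign a)ᴴ = embSign a := by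
  rw [embSign, conjTranspose_sub, conjTranspose_embProj, conjTranspose_embProj]

variable [Nontrivial a]

theorem inv_trace_mul_trace_smul_tracelessProj (ε : ℤˣ) :
    ((tracelessProj a ε).trace⁻¹ * (tracelessProj a ε).trace) • tracelessProj a ε =
      tracelessProj a ε := by
  rcases eq_or_ne (tracelessProj a ε).trace 0 with h | h
  · have h_zero : tracelessProj a ε = 0 := by
      exact (posSemidef_of_isStarProjection
        (isStarProjection_tracelessProj a ε)).trace_eq_zero_iff.mp h
    rw [h_zero, smul_zero]
  · rw [inv_mul_cancel₀ h, one_smul]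

theorem momentMap_tracelessProj (δ : ℤˣ) :
    momentMap a (tracelessProj a δ) = tracelessProj a δ := by
  rw [momentMap_apply, Finset.sum_eq_single δ]
  · rw [tracelessProj_mul_tracelessProj, if_pos rfl, embProj_mul_tracelessProj, trace_zero,
      mul_zero, zero_smul, add_zero, inv_trace_mul_trace_smul_tracelessProj]
  · intro ε _ h
    simp [tracelessProj_mul_tracelessProj, h, embProj_mul_tracelessProj]
  · exact fun h => (h (Finset.mem_univ _)).elim

theorem momentMap_symUnit (γ δ : ℤˣ) :
    momentMap a (symUnit a γ δ) = if γ = δ then (2 : ℂ) • symUnit a γ δ else 0 := by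
  have h_card : (Fintype.card a : ℂ) ≠ 0 := Nat.cast_ne_zero.mpr Fintype.card_ne_zero
  have := card_add_sign_ne_zero a γ
  rw [momentMap_apply, Finset.sum_eq_single γ]
  · rw [tracelessProj_mul_symUnit, trace_zero, mul_zero, zero_smul, zero_add,
      embProj_mul_symUnit, if_pos rfl, trace_symUnit]
    split_ifs with h
    · subst h
      rw [embProj, smul_smul]
      congr 1
      field_simp
    · simp
  · intro ε _ h
    simp [tracelessProj_mul_symUnit, embProj_mul_symUnit, h]
  · exact fun h => (h (Finset.mem_univ _)).elim

theorem embSign_mul_tracelessProj (ε : ℤˣ) : embSign a * tracelessProj a ε = 0 := by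
  rw [embSign, Matrix.sub_mul, embProj_mul_tracelessProj, embProj_mul_tracelessProj, sub_zero]

theorem embSign_mul_symUnit (γ δ : ℤˣ) :
    embSign a * symUnit a γ δ = ((γ : ℤ) : ℂ) • symUnit a γ δ := by
  rw [embSign, Matrix.sub_mul, embProj_mul_symUnit, embProj_mul_symUnit]
  rcases Int.units_eq_one_or γ with rfl | rfl <;> simp

theorem symUnit_mul_embSign (γ δ : ℤˣ) :
    symUnit a γ δ * embSign a = ((δ : ℤ) : ℂ) • symUnit a γ δ := by
  rw [embSign, Matrix.mul_sub, symUnit_mul_embProj, symUnit_mul_embProj]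
  rcases Int.units_eq_one_or δ with rfl | rfl <;> simp

theorem conjBy_embSign_symUnit (γ δ : ℤˣ) : conjBy (embSign a) (symUnit a γ δ) =
    (((γ : ℤ) : ℂ) * ((δ : ℤ) : ℂ)) • symUnit a γ δ := by
  rw [conjBy, sandwich_apply, conjTranspose_embSign, embSign_mul_symUnit, Matrix.smul_mul,
    symUnit_mul_embSign, smul_smul]

theorem add_conjBy_embSign_of_mem_tripleAlgebra {X : Matrix ((a × a) × a) ((a × a) × a) ℂ}
    (hX : X ∈ tripleAlgebra a) : X + conjBy (embSign a) X = momentMap a X := by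
  refine tripleAlgebra_le (S := LinearMap.eqLocus (LinearMap.id + conjBy (embSign a)) (momentMap a))
    (fun ε => ?_) (fun γ δ => ?_) hX <;>
    rw [LinearMap.mem_eqLocus, LinearMap.add_apply, LinearMap.id_apply]
  · rw [conjBy, sandwich_apply, embSign_mul_tracelessProj, Matrix.zero_mul, add_zero,
      momentMap_tracelessProj]
  · rw [conjBy_embSign_symUnit, momentMap_symUnit]
    split_ifs with h
    · rw [h, sign_mul_self, one_smul, two_smul]
    · rw [Int.units_ne_iff_eq_neg.mp h]
      simp

variable [MeasurableSpace (unitaryGroup a ℂ)] [BorelSpace (unitaryGroup a ℂ)]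
  (μ : Measure (unitaryGroup a ℂ)) [IsProbabilityMeasure μ] [μ.IsMulLeftInvariant]

theorem momentMap_sub_twirl :
    momentMap a - twirl tripleRep μ = conjBy (embSign a) ∘ₗ twirl tripleRep μ := by
  refine LinearMap.ext fun X => ?_
  rw [LinearMap.sub_apply, LinearMap.comp_apply, sub_eq_iff_eq_add', ← momentMap_twirl μ,
    add_conjBy_embSign_of_mem_tripleAlgebra (mem_tripleAlgebra_of_commute (commute_twirl _ μ X))]

theorem isCP_momentMap_sub_twirl : IsCP (momentMap a - twirl tripleRep μ) := by
  rw [momentMap_sub_twirl]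
  exact (isCP_conjBy _).comp (isCP_twirl _ μ)

end Moment

section DualBound

theorem trace_mul_nonneg_of_posSemidef {n : Type*} [Fintype n] {X Y : Matrix n n ℂ}
    (hX : X.PosSemidef) (hY : Y.PosSemidef) : 0 ≤ (X * Y).trace := by
  classical
  obtain ⟨B, rfl⟩ := exists_conjTranspose_mul_self hX
  rw [Matrix.mul_assoc, Matrix.trace_mul_comm]
  exact (hY.mul_mul_conjTranspose_same B).trace_nonneg

theorem choi_momentMap {a : Type} [Fintype a] [DecidableEq a] : choi (momentMap a) =
    ∑ ε : ℤˣ, ((tracelessProj a ε).trace⁻¹ • (tracelessProj a ε ⊗ₖ tracelessProj a ε) +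
      (2 / Fintype.card a : ℂ) • (embProj a ε ⊗ₖ embProj a ε)) := by
  simp only [momentMap, choi_sum, choi_add, choi_smul, choi_measurePrepare,
    transpose_tracelessProj, transpose_embProj]

theorem posSemidef_tracelessProj {a : Type*} [Fintype a] [DecidableEq a] [Nontrivial a] (ε : ℤˣ) :
    (tracelessProj a ε).PosSemidef :=
  posSemidef_of_isStarProjection (isStarProjection_tracelessProj a ε)

theorem posSemidef_embProj {a : Type*} [Fintype a] [DecidableEq a] [Nontrivial a] (ε : ℤˣ) :
    (embProj a ε).PosSemidef :=
  posSemidef_of_isStarProjection (isStarProjection_embProj a ε)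

theorem two_div_card_nonneg (a : Type*) [Fintype a] : (0 : ℂ) ≤ 2 / Fintype.card a :=
  div_nonneg zero_le_two (Nat.cast_nonneg _)

theorem posSemidef_choi_momentMap {a : Type} [Fintype a] [DecidableEq a] [Nontrivial a] :
    (choi (momentMap a)).PosSemidef := by
  rw [choi_momentMap]
  refine posSemidef_sum _ fun ε _ => .add (.smul ?_ ?_) (.smul ?_ (two_div_card_nonneg a))
  · exact (posSemidef_tracelessProj ε).kronecker (posSemidef_tracelessProj ε)
  · exact inv_nonneg.mpr (posSemidef_tracelessProj ε).trace_nonneg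
  · exact (posSemidef_embProj ε).kronecker (posSemidef_embProj ε)

theorem trace_choi_forward_mul_choi {a : Type} [Fintype a] [DecidableEq a]
    (S : OpMap (a × a) (a × a) →ₗ[ℂ] OpMap a a) (U : unitaryGroup a ℂ) :
    (choi (forward S (conjBy U.1) (conjBy U.1)) * choi (conjBy U.1ᵀ)).trace =
      (superChoi S * choi (conjBy (tripleRep U).1)).trace := by
  have h_sum (f : ((a × a) × a) × ((a × a) × a) → ℂ) :
      ∑ x, f x = ∑ p : a × a, ∑ q : (a × a) × (a × a), f ((q.1, p.2), (q.2, p.1)) := by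
    rw [← Fintype.sum_prod_type' (f := fun (p : a × a) (q : (a × a) × (a × a)) =>
      f ((q.1, p.2), (q.2, p.1)))]
    exact Fintype.sum_equiv
      ⟨fun x => ((x.2.2, x.1.2), (x.1.1, x.2.1)), fun y => ((y.2.1, y.1.2), (y.2.2, y.1.1)),
        fun _ => rfl, fun _ => rfl⟩ _ _ fun _ => rfl
  rw [Matrix.trace, Matrix.trace, h_sum]
  simp only [Matrix.diag_apply, Matrix.mul_apply, h_sum]
  refine Finset.sum_congr rfl fun p _ => ?_
  rw [Finset.sum_comm (s := (Finset.univ : Finset ((a × a) × (a × a))))]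
  refine Finset.sum_congr rfl fun q _ => ?_
  rw [choi_apply, forward, supermap_apply_single, Finset.sum_mul]
  refine Finset.sum_congr rfl fun u _ => ?_
  rw [Finset.sum_mul]
  refine Finset.sum_congr rfl fun v _ => ?_
  rw [choi_tensorMap]
  simp only [Matrix.submatrix_apply, Matrix.kroneckerMap_apply, conjBy, choi_sandwich,
    coe_tripleRep, Matrix.transpose_apply, Matrix.map_apply, star_mul', star_star]
  ring

end DualBound

section FidelityIntegral

open scoped Matrix.Norms.L2Operator

variable {d : ℕ} (S : OpMap (Fin d × Fin d) (Fin d × Fin d) →ₗ[ℂ] OpMap (Fin d) (Fin d))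
  [MeasurableSpace (unitaryGroup (Fin d) ℂ)] [BorelSpace (unitaryGroup (Fin d) ℂ)]
  (μ : Measure (unitaryGroup (Fin d) ℂ)) [IsProbabilityMeasure μ]

theorem integrable_transposeFidelity :
    Integrable (fun U : unitaryGroup (Fin d) ℂ => transposeFidelity S U.1) μ := by
  simp only [transposeFidelity, trace_choi_forward_mul_choi]
  refine Continuous.integrable_of_hasCompactSupport ?_ (.of_compactSpace _)
  have := continuous_choi_conjBy_rep (tripleRep (a := Fin d))
  fun_prop

theorem integral_transposeFidelity :
    ∫ U : unitaryGroup (Fin d) ℂ, transposeFidelity S U.1 ∂μ =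
      (superChoi S * choi (twirl tripleRep μ)).trace.re / (d : ℝ) ^ 2 := by
  let f := Complex.reLm ∘ₗ
    (traceLinearMap _ ℂ ℂ ∘ₗ LinearMap.mulLeft ℂ (superChoi S)).restrictScalars ℝ
  have h_map := f.toContinuousLinearMap.integral_comp_comm (integrable_of_continuous (μ := μ)
    (continuous_choi_conjBy_rep (tripleRep (a := Fin d))))
  rw [choi_twirl]
  simp only [transposeFidelity, trace_choi_forward_mul_choi, integral_div]
  exact congrArg (· / (d : ℝ) ^ 2) h_map

end FidelityIntegral

section DualOperator

variable {d : ℕ} {G : Matrix ((Fin d × Fin d) × Fin d) ((Fin d × Fin d) × Fin d) ℂ} {β : ℂ}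

/-- The operator `swapFamily G β ⊗ 1`, with its six tensor factors regrouped as in `superChoi`. -/
noncomputable def dualOperator (G : Matrix ((Fin d × Fin d) × Fin d) ((Fin d × Fin d) × Fin d) ℂ)
    (β : ℂ) : Matrix (((Fin d × Fin d) × Fin d) × ((Fin d × Fin d) × Fin d))
      (((Fin d × Fin d) × Fin d) × ((Fin d × Fin d) × Fin d)) ℂ :=
  G ⊗ₖ 1 + β • ((swap₁₂ (Fin d) - (d : ℂ)⁻¹ • 1) ⊗ₖ swap₁₂ (Fin d))

theorem submatrix_swapFamily_kronecker_one :
    (swapFamily G β ⊗ₖ (1 : Matrix (Fin d) (Fin d) ℂ)).submatrix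
      (Equiv.prodAssoc _ _ _).symm (Equiv.prodAssoc _ _ _).symm = dualOperator G β := by
  ext x y
  simp only [swapFamily, dualOperator, swap₁₂, ← Matrix.one_kronecker_one (m := Fin d × Fin d),
    Matrix.submatrix_apply, Matrix.kroneckerMap_apply, Matrix.add_apply, Matrix.sub_apply,
    Matrix.smul_apply, smul_eq_mul, Fintype.card_fin, Equiv.prodAssoc_symm_apply]
  ring

variable [Nontrivial (Fin d)]

theorem posSemidef_swapFamily (h : (dualOperator G β).PosSemidef) :
    (swapFamily G β).PosSemidef := by
  obtain ⟨i₀⟩ : Nonempty (Fin d) := inferInstance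
  rw [← submatrix_swapFamily_kronecker_one] at h
  convert h.submatrix
    fun u : ((Fin d × Fin d) × Fin d) × (Fin d × Fin d) => (u.1, (u.2, i₀)) using 1
  ext u v
  simp

variable {S : OpMap (Fin d × Fin d) (Fin d × Fin d) →ₗ[ℂ] OpMap (Fin d) (Fin d)}

theorem IsSupermap.trace_superChoi_mul_dualOperator (hS : IsSupermap S)
    (h : (dualOperator G β).PosSemidef) (hGt : Gᵀ = G) (hG : partialTrace G = 1) :
    (superChoi S * dualOperator G β).trace = d := by
  have hN := posSemidef_swapFamily h
  rw [← hS.trace_superChoi_mul (isChannel_slotMap_swapFamily hN hG)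
    fun σ hσ => isNoSignalling_reduced_slotMap_swapFamily hN hG hσ, transpose_swapFamily hGt,
    submatrix_swapFamily_kronecker_one]

theorem IsSupermap.integral_transposeFidelity_le
    [MeasurableSpace (unitaryGroup (Fin d) ℂ)] [BorelSpace (unitaryGroup (Fin d) ℂ)]
    (μ : Measure (unitaryGroup (Fin d) ℂ)) [IsProbabilityMeasure μ] [μ.IsMulLeftInvariant]
    (hS : IsSupermap S) {t : ℝ} (ht : 0 < t) (hGt : Gᵀ = G) (hG : partialTrace G = 1)
    (h : ((t : ℂ) • dualOperator G β - choi (momentMap (Fin d))).PosSemidef) :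
    ∫ U : unitaryGroup (Fin d) ℂ, transposeFidelity S U.1 ∂μ ≤ t / d := by
  have hd : (0 : ℝ) < d := Nat.cast_pos.mpr (Fin.pos (Classical.arbitrary (Fin d)))
  have h_dual : (dualOperator G β).PosSemidef := by
    have h_smul := (h.add posSemidef_choi_momentMap).smul
      (inv_nonneg.mpr (Complex.zero_le_real.mpr ht.le))
    rwa [sub_add_cancel, inv_smul_smul₀ (Complex.ofReal_ne_zero.mpr ht.ne')] at h_smul
  have h_choi := hS.posSemidef_superChoi
  have h_twirl := trace_mul_nonneg_of_posSemidef h_choi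
    (isCP_momentMap_sub_twirl μ).posSemidef_choi
  have h_moment := trace_mul_nonneg_of_posSemidef h_choi h
  rw [choi_sub, Matrix.mul_sub, Matrix.trace_sub, sub_nonneg] at h_twirl
  rw [Matrix.mul_sub, Matrix.trace_sub, Matrix.mul_smul, Matrix.trace_smul,
    hS.trace_superChoi_mul_dualOperator h_dual hGt hG, sub_nonneg] at h_moment
  have h_le : (superChoi S * choi (twirl tripleRep μ)).trace.re ≤ t * d := by
    simpa using (Complex.le_def.mp (h_twirl.trans h_moment)).1
  rw [integral_transposeFidelity, div_le_div_iff₀ (by positivity) hd, sq, ← mul_assoc]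
  exact mul_le_mul_of_nonneg_right h_le hd.le

end DualOperator

section LargeDimension

variable {a : Type} [Fintype a] [DecidableEq a]

variable (a) in
/-- The operator obtained from `choi (momentMap a)` by dropping the second factor of each term. -/
noncomputable def momentWeight : Matrix ((a × a) × a) ((a × a) × a) ℂ :=
  ∑ ε : ℤˣ, ((tracelessProj a ε).trace⁻¹ • tracelessProj a ε +
    (2 / Fintype.card a : ℂ) • embProj a ε)

theorem transpose_momentWeight : (momentWeight a)ᵀ = momentWeight a := by
  simp only [momentWeight, Matrix.transpose_sum, Matrix.transpose_add, Matrix.transpose_smul,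
    transpose_tracelessProj, transpose_embProj]

variable [Nontrivial a]

theorem posSemidef_momentWeight_kronecker_one_sub :
    (momentWeight a ⊗ₖ 1 - choi (momentMap a)).PosSemidef := by
  have h_eq : momentWeight a ⊗ₖ 1 - choi (momentMap a) =
      ∑ ε : ℤˣ, ((tracelessProj a ε).trace⁻¹ • (tracelessProj a ε ⊗ₖ (1 - tracelessProj a ε)) +
        (2 / Fintype.card a : ℂ) • (embProj a ε ⊗ₖ (1 - embProj a ε))) := by
    ext x y
    simp only [momentWeight, choi_momentMap, Matrix.sub_apply, Matrix.kroneckerMap_apply,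
      Matrix.sum_apply, Matrix.add_apply, Matrix.smul_apply, smul_eq_mul, Finset.sum_mul,
      ← Finset.sum_sub_distrib]
    exact Finset.sum_congr rfl fun _ _ => by ring
  rw [h_eq]
  refine posSemidef_sum _ fun ε _ => .add (.smul ?_ ?_) (.smul ?_ (two_div_card_nonneg a))
  · exact (posSemidef_tracelessProj ε).kronecker
      (posSemidef_of_isStarProjection (isStarProjection_tracelessProj a ε).one_sub)
  · exact inv_nonneg.mpr (posSemidef_tracelessProj ε).trace_nonneg
  · exact (posSemidef_embProj ε).kronecker
      (posSemidef_of_isStarProjection (isStarProjection_embProj a ε).one_sub)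

theorem trace_tracelessProj_ne_zero (ha : 2 < Fintype.card a) (ε : ℤˣ) :
    (tracelessProj a ε).trace ≠ 0 := by
  have h_factor : (tracelessProj a ε).trace = Fintype.card a *
      (Fintype.card a + (((-ε : ℤˣ) : ℤ) : ℂ)) * (Fintype.card a + 2 * ((ε : ℤ) : ℂ)) / 2 := by
    rw [trace_tracelessProj]
    push_cast
    linear_combination (Fintype.card a : ℂ) * sign_mul_self ε
  have h_add : (Fintype.card a + 2 * ((ε : ℤ) : ℂ)) ≠ 0 := by
    norm_cast
    rcases Int.units_eq_one_or ε with rfl | rfl <;> push_cast <;> omega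
  rw [h_factor]
  exact div_ne_zero (mul_ne_zero (mul_ne_zero (Nat.cast_ne_zero.mpr Fintype.card_ne_zero)
    (card_add_sign_ne_zero a _)) h_add) two_ne_zero

theorem partialTrace_momentWeight (ha : 2 < Fintype.card a) :
    partialTrace (momentWeight a) = (6 / Fintype.card a : ℂ) • 1 := by
  simp only [momentWeight, map_sum, map_add, map_smul, partialTrace_tracelessProj,
    partialTrace_embProj, smul_smul, inv_mul_eq_div, ← add_smul]
  rw [← Finset.sum_smul]
  congr 1
  simp only [div_div_cancel_left' (trace_tracelessProj_ne_zero ha _), Finset.sum_const,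
    Finset.card_univ, Fintype.card_units_int, nsmul_eq_mul, Nat.cast_ofNat]
  ring

end LargeDimension

theorem IsSupermap.integral_transposeFidelity_le_of_two_lt {d : ℕ} (hd : 2 < d)
    [MeasurableSpace (unitaryGroup (Fin d) ℂ)] [BorelSpace (unitaryGroup (Fin d) ℂ)]
    (μ : Measure (unitaryGroup (Fin d) ℂ)) [IsProbabilityMeasure μ] [μ.IsMulLeftInvariant]
    {S : OpMap (Fin d × Fin d) (Fin d × Fin d) →ₗ[ℂ] OpMap (Fin d) (Fin d)} (hS : IsSupermap S) :
    ∫ U : unitaryGroup (Fin d) ℂ, transposeFidelity S U.1 ∂μ ≤ 6 / (d : ℝ) ^ 2 := by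
  have : Nontrivial (Fin d) := Fin.nontrivial_iff_two_le.mpr hd.le
  have hd₀ : (d : ℂ) ≠ 0 := Nat.cast_ne_zero.mpr (by omega)
  have h_dual : ((6 / d : ℝ) : ℂ) • dualOperator ((d / 6 : ℂ) • momentWeight (Fin d)) 0 =
      momentWeight (Fin d) ⊗ₖ 1 := by
    rw [dualOperator, zero_smul, add_zero, smul_kronecker, smul_smul]
    push_cast
    rw [div_mul_div_cancel₀ hd₀, div_self (by norm_num), one_smul]
  rw [sq, ← div_div]
  refine hS.integral_transposeFidelity_le μ (G := (d / 6 : ℂ) • momentWeight (Fin d)) (β := 0)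
    (by positivity) ?_ ?_ ?_
  · rw [transpose_smul, transpose_momentWeight]
  · rw [map_smul, partialTrace_momentWeight (by simpa using hd), Fintype.card_fin, smul_smul,
      div_mul_div_cancel₀ (by norm_num), div_self hd₀, one_smul]
  · rw [h_dual]
    exact posSemidef_momentWeight_kronecker_one_sub

section Qubit

theorem trace_tracelessProj_one_fin_two : (tracelessProj (Fin 2) 1).trace = 4 := by
  rw [trace_tracelessProj]
  norm_num

theorem tracelessProj_neg_one_fin_two : tracelessProj (Fin 2) (-1) = 0 := by
  refine (posSemidef_tracelessProj (-1)).trace_eq_zero_iff.mp ?_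
  rw [trace_tracelessProj]
  norm_num

theorem tracelessProj_add_embProj_add_embProj_fin_two :
    tracelessProj (Fin 2) 1 + embProj (Fin 2) 1 + embProj (Fin 2) (-1) = 1 := by
  rw [← sum_proj_eq_one, tracelessProj_neg_one_fin_two, add_zero, add_assoc]

theorem swap₁₂_fin_two : swap₁₂ (Fin 2) =
    tracelessProj (Fin 2) 1 + embProj (Fin 2) 1 - embProj (Fin 2) (-1) := by
  have h_neg : embProj (Fin 2) (-1) = symProj (Fin 2) (-1) :=
    (sub_eq_zero.mp tracelessProj_neg_one_fin_two).symm
  rw [h_neg, tracelessProj, sub_add_cancel, symProj, symProj]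
  push_cast
  module

theorem choi_momentMap_fin_two : choi (momentMap (Fin 2)) =
    (1 / 4 : ℂ) • (tracelessProj (Fin 2) 1 ⊗ₖ tracelessProj (Fin 2) 1) +
      embProj (Fin 2) 1 ⊗ₖ embProj (Fin 2) 1 + embProj (Fin 2) (-1) ⊗ₖ embProj (Fin 2) (-1) := by
  have h_sum (f : ℤˣ → Matrix (((Fin 2 × Fin 2) × Fin 2) × ((Fin 2 × Fin 2) × Fin 2))
      (((Fin 2 × Fin 2) × Fin 2) × ((Fin 2 × Fin 2) × Fin 2)) ℂ) :
      ∑ ε, f ε = f 1 + f (-1) := by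
    rw [UnitsInt.univ, Finset.sum_pair (by decide)]
  rw [choi_momentMap, h_sum, tracelessProj_neg_one_fin_two, trace_tracelessProj_one_fin_two,
    zero_kronecker, smul_zero, zero_add, Fintype.card_fin, Nat.cast_ofNat, div_self two_ne_zero,
    one_smul, one_smul, one_div]

/-- The operator used in place of `momentWeight` in dimension two, together with `β = 1 / 5`. These
coefficients make five of the nine blocks of `smul_dualOperator_qubitWeight_sub` vanish. -/
noncomputable def qubitWeight :
    Matrix ((Fin 2 × Fin 2) × Fin 2) ((Fin 2 × Fin 2) × Fin 2) ℂ :=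
  (1 / 10 : ℂ) • tracelessProj (Fin 2) 1 + (1 / 2 : ℂ) • embProj (Fin 2) 1 +
    (3 / 10 : ℂ) • embProj (Fin 2) (-1)

theorem transpose_qubitWeight : qubitWeightᵀ = qubitWeight := by
  simp only [qubitWeight, transpose_add, transpose_smul, transpose_tracelessProj,
    transpose_embProj]

theorem partialTrace_qubitWeight : partialTrace qubitWeight = 1 := by
  simp only [qubitWeight, map_add, map_smul, partialTrace_tracelessProj, partialTrace_embProj,
    trace_tracelessProj_one_fin_two, Fintype.card_fin, Nat.cast_ofNat]
  module

theorem smul_dualOperator_qubitWeight_sub : (5 / 3 : ℂ) • dualOperator qubitWeight (1 / 5) -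
    choi (momentMap (Fin 2)) =
      tracelessProj (Fin 2) 1 ⊗ₖ
        ((1 / 12 : ℂ) • tracelessProj (Fin 2) 1 + (1 / 3 : ℂ) • embProj (Fin 2) 1) +
      embProj (Fin 2) 1 ⊗ₖ (tracelessProj (Fin 2) 1 + (2 / 3 : ℂ) • embProj (Fin 2) (-1)) := by
  rw [dualOperator, choi_momentMap_fin_two, swap₁₂_fin_two,
    ← tracelessProj_add_embProj_add_embProj_fin_two, qubitWeight]
  ext x y
  simp only [Matrix.sub_apply, Matrix.add_apply, Matrix.smul_apply, kroneckerMap_apply, smul_eq_mul]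
  push_cast
  ring

theorem posSemidef_smul_dualOperator_qubitWeight_sub :
    ((5 / 3 : ℂ) • dualOperator qubitWeight (1 / 5) - choi (momentMap (Fin 2))).PosSemidef := by
  have h_traceless := posSemidef_tracelessProj (a := Fin 2) 1
  have h_pos := posSemidef_embProj (a := Fin 2) 1
  have h_neg := posSemidef_embProj (a := Fin 2) (-1)
  rw [smul_dualOperator_qubitWeight_sub]
  exact (h_traceless.kronecker ((h_traceless.smul (by positivity)).add
    (h_pos.smul (by positivity)))).add
      (h_pos.kronecker (h_traceless.add (h_neg.smul (by positivity))))

theorem IsSupermap.integral_transposeFidelity_le_of_eq_two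
    [MeasurableSpace (unitaryGroup (Fin 2) ℂ)] [BorelSpace (unitaryGroup (Fin 2) ℂ)]
    (μ : Measure (unitaryGroup (Fin 2) ℂ)) [IsProbabilityMeasure μ] [μ.IsMulLeftInvariant]
    {S : OpMap (Fin 2 × Fin 2) (Fin 2 × Fin 2) →ₗ[ℂ] OpMap (Fin 2) (Fin 2)} (hS : IsSupermap S) :
    ∫ U : unitaryGroup (Fin 2) ℂ, transposeFidelity S U.1 ∂μ ≤ 5 / 6 := by
  have h_le := hS.integral_transposeFidelity_le μ (t := 5 / 3) (by norm_num)
    transpose_qubitWeight partialTrace_qubitWeight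
    (by simpa using posSemidef_smul_dualOperator_qubitWeight_sub)
  exact h_le.trans_eq (by norm_num)

end Qubit

section Compression

variable {a b a' b' : Type}

/-- Precomposition with `pre` and postcomposition with `post`. -/
def compress (pre : OpMap a' a) (post : OpMap b b') : OpMap a b →ₗ[ℂ] OpMap a' b' where
  toFun Φ := post ∘ₗ Φ ∘ₗ pre
  map_add' Φ Ψ := by rw [LinearMap.add_comp, LinearMap.comp_add]
  map_smul' r Φ := by rw [LinearMap.smul_comp, LinearMap.comp_smul, RingHom.id_apply]

theorem compress_apply (pre : OpMap a' a) (post : OpMap b b') (Φ : OpMap a b) :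
    compress pre post Φ = post ∘ₗ Φ ∘ₗ pre := rfl

variable {Ai Ao Bi Bo Ci Co Di Do : Type}
  [Fintype Di] [DecidableEq Di]

theorem block_localAction (S : OpMap Ai Ao →ₗ[ℂ] OpMap Ci Co) (M : OpMap (Ai × Di) (Ao × Do))
    (Y : Matrix (Ci × Di) (Ci × Di) ℂ) (k' l' : Do) : block k' l' (localAction S M Y) =
      ∑ k, ∑ l, S (component M k l k' l') (block k l Y) := by
  ext i j
  simp only [block_apply, localAction_apply, Matrix.sum_apply]

theorem localAction_compress_comp [Fintype Do] [DecidableEq Do] (S : OpMap Ai Ao →ₗ[ℂ] OpMap a b)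
    (pre : OpMap a' a) (post : OpMap b b') (M : OpMap (Ai × Di) (Ao × Do)) :
    localAction (compress pre post ∘ₗ S) M =
      tensorMap post (LinearMap.id : OpMap Do Do) ∘ₗ localAction S M ∘ₗ
        tensorMap pre (LinearMap.id : OpMap Di Di) := by
  refine LinearMap.ext fun Y => ?_
  ext p q
  simp only [LinearMap.comp_apply, tensorMap_id_apply, block_localAction, block_tensorMap_id,
    localAction_apply, compress_apply, map_sum, Matrix.sum_apply]

theorem IsSupermap.compress_comp [Fintype Ai] [Fintype Ao] [Fintype Bi] [DecidableEq Bi]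
    [Fintype Bo] [Fintype a] [Fintype b] [Fintype a'] [Fintype b']
    {S : OpMap (Ai × Bi) (Ao × Bo) →ₗ[ℂ] OpMap a b}
    (hS : IsSupermap S) {pre : OpMap a' a} {post : OpMap b b'} (hpre : IsChannel pre)
    (hpost : IsChannel post) : IsSupermap (compress pre post ∘ₗ S) := by
  classical
  refine ⟨fun N hN => hpost.comp ((hS.1 N hN).comp hpre), fun m n M hM hM' => ?_⟩
  rw [localAction_compress_comp]
  exact (isChannel_tensorMap hpost isChannel_id).comp
    ((hS.2 m n M hM hM').comp (isChannel_tensorMap hpre isChannel_id))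

end Compression

section Control

variable {a : Type} [Fintype a] [DecidableEq a]

/-- The operator `A ⊗ |k⟩`, which prepares the control qubit of a time flip. -/
def controlEmb (A : Matrix a a ℂ) (k : Fin 2) : Matrix (a × Fin 2) a ℂ :=
  Matrix.of fun p j => if p.2 = k then A p.1 j else 0

theorem isChannel_conjBy_controlEmb {A : Matrix a a ℂ} (hA : A ∈ unitaryGroup a ℂ) (k : Fin 2) :
    IsChannel (conjBy (controlEmb A k)) := by
  refine isChannel_conjBy (Eq.trans ?_ (mem_unitaryGroup_iff'.mp hA))
  ext i j
  simp [Matrix.mul_apply, controlEmb, Fintype.sum_prod_type, apply_ite]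

theorem sum_controlEmb_mul_conjTranspose {A : Matrix a a ℂ} (hA : A ∈ unitaryGroup a ℂ) :
    ∑ k, controlEmb A k * (controlEmb A k)ᴴ = 1 := by
  ext ⟨i, k⟩ ⟨j, l⟩
  have h_entry := congrFun₂ (mem_unitaryGroup_iff.mp hA) i j
  simp only [Matrix.mul_apply, Matrix.star_apply, Matrix.one_apply, ← starRingEnd_apply] at h_entry
  fin_cases k <;> fin_cases l <;>
    simp [Matrix.mul_apply, controlEmb, Matrix.one_apply, h_entry]

/-- The compression that fixes the control qubit in the state `|k⟩`, conjugates the target system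
by `A`, and discards the control qubit. -/
def controlMap (A : Matrix a a ℂ) (k : Fin 2) :
    OpMap (a × Fin 2) (a × Fin 2) →ₗ[ℂ] OpMap a a :=
  compress (conjBy (controlEmb A k)) (krausMap fun l => (controlEmb A l)ᴴ)

theorem isChannel_krausMap_controlEmb {A : Matrix a a ℂ} (hA : A ∈ unitaryGroup a ℂ) :
    IsChannel (krausMap fun l => (controlEmb A l)ᴴ) :=
  isChannel_krausMap (by simpa using sum_controlEmb_mul_conjTranspose hA)

theorem IsChannel.controlMap {A : Matrix a a ℂ} (hA : A ∈ unitaryGroup a ℂ) (k : Fin 2)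
    {Φ : OpMap (a × Fin 2) (a × Fin 2)} (hΦ : IsChannel Φ) : IsChannel (controlMap A k Φ) :=
  (isChannel_krausMap_controlEmb hA).comp (hΦ.comp (isChannel_conjBy_controlEmb hA k))

theorem IsSupermap.controlMap_comp {Ai Ao Bi Bo : Type} [Fintype Ai] [Fintype Ao]
    [Fintype Bi] [DecidableEq Bi] [Fintype Bo]
    {S : OpMap (Ai × Bi) (Ao × Bo) →ₗ[ℂ] OpMap (a × Fin 2) (a × Fin 2)} (hS : IsSupermap S)
    {A : Matrix a a ℂ} (hA : A ∈ unitaryGroup a ℂ) (k : Fin 2) :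
    IsSupermap (controlMap A k ∘ₗ S) :=
  hS.compress_comp (isChannel_conjBy_controlEmb hA k) (isChannel_krausMap_controlEmb hA)

theorem conjTranspose_controlEmb_mul_flipOp_mul_controlEmb (W A U : Matrix a a ℂ) (k l : Fin 2) :
    (controlEmb A k)ᴴ * flipOp W U * controlEmb A l =
      if k = l then Aᴴ * (if l = 0 then U else theta W U) * A else 0 := by
  have h_flip (p q : a × Fin 2) : flipOp W U p q =
      (U ⊗ₖ Matrix.single 0 0 1 + theta W U ⊗ₖ Matrix.single 1 1 1 :
        Matrix (a × Fin 2) (a × Fin 2) ℂ) p q := rfl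
  ext i j
  fin_cases k <;> fin_cases l <;>
    simp [Matrix.mul_apply, controlEmb, Fintype.sum_prod_type, Matrix.single_apply, h_flip]

theorem controlMap_timeFlip_conjBy (W A U : Matrix a a ℂ) (l : Fin 2) :
    controlMap A l (timeFlip W (conjBy U)) =
      conjBy (Aᴴ * (if l = 0 then U else theta W U) * A) := by
  rw [timeFlip, liftKraus_conjBy]
  refine LinearMap.ext fun Z => ?_
  have h_kraus (k : Fin 2) : (controlEmb A k)ᴴ *
      (flipOp W U * (controlEmb A l * Z * (controlEmb A l)ᴴ) * (flipOp W U)ᴴ) *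
      (controlEmb A k)ᴴᴴ =
        ((controlEmb A k)ᴴ * flipOp W U * controlEmb A l) * Z *
          ((controlEmb A k)ᴴ * flipOp W U * controlEmb A l)ᴴ := by
    simp only [Matrix.conjTranspose_mul, Matrix.mul_assoc]
  simp only [controlMap, compress_apply, LinearMap.comp_apply, krausMap_apply, conjBy,
    sandwich_apply, h_kraus, conjTranspose_controlEmb_mul_flipOp_mul_controlEmb]
  rw [Finset.sum_eq_single l (fun k _ hk => by simp [hk]) (by simp), if_pos rfl]

end Control

section Fidelity

variable {a : Type} [Fintype a] [DecidableEq a]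

theorem choi_conjBy_mul_self {K : Matrix a a ℂ} (hK : Kᴴ * K = 1) :
    choi (conjBy K) * choi (conjBy K) = (Fintype.card a : ℂ) • choi (conjBy K) := by
  have h_norm : ∑ r : a × a, star (K r.1 r.2) * K r.1 r.2 = Fintype.card a := by
    rw [Fintype.sum_prod_type_right]
    simpa [Matrix.trace, Matrix.mul_apply] using congrArg Matrix.trace hK
  ext p q
  simp only [conjBy, Matrix.mul_apply, choi_sandwich, Matrix.smul_apply, smul_eq_mul, ← h_norm,
    Finset.sum_mul]
  exact Finset.sum_congr rfl fun r _ => by ring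

theorem isStarProjection_smul_choi_conjBy {K : Matrix a a ℂ} (hK : Kᴴ * K = 1) :
    IsStarProjection ((Fintype.card a : ℂ)⁻¹ • choi (conjBy K)) := by
  refine ⟨?_, ?_⟩
  · cases isEmpty_or_nonempty a
    · exact Subsingleton.elim _ _
    · rw [IsIdempotentElem, Matrix.smul_mul, Matrix.mul_smul, choi_conjBy_mul_self hK,
        inv_smul_smul₀ (Nat.cast_ne_zero.mpr Fintype.card_ne_zero)]
  · rw [IsSelfAdjoint, star_smul, star_inv₀, star_natCast, Matrix.star_eq_conjTranspose,
      (isCP_conjBy K).posSemidef_choi.isHermitian]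

theorem IsChannel.trace_choi {b : Type} [Fintype b] {Φ : OpMap a b} (h : IsChannel Φ) :
    (choi Φ).trace = Fintype.card a := by
  have h_trace : (choi Φ).trace = ∑ m : a, (Φ (Matrix.single m m 1)).trace := by
    simp only [Matrix.trace, Matrix.diag_apply, choi_apply, Fintype.sum_prod_type_right]
  simp [h_trace, h.2]

theorem trace_choi_conjBy_mul_self {K : Matrix a a ℂ} (hK : Kᴴ * K = 1) :
    (choi (conjBy K) * choi (conjBy K)).trace = (Fintype.card a : ℂ) ^ 2 := by
  rw [choi_conjBy_mul_self hK, trace_smul, (isChannel_conjBy hK).trace_choi, smul_eq_mul, sq]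

theorem IsChannel.trace_choi_mul_choi_conjBy_le {Φ : OpMap a a} (h : IsChannel Φ)
    {K : Matrix a a ℂ} (hK : Kᴴ * K = 1) :
    ((choi Φ * choi (conjBy K)).trace).re ≤ (Fintype.card a : ℝ) ^ 2 := by
  cases isEmpty_or_nonempty a
  · simp [Matrix.trace]
  have h_nonneg := Complex.re_le_re (trace_mul_nonneg_of_posSemidef h.1.posSemidef_choi
    (posSemidef_of_isStarProjection (isStarProjection_smul_choi_conjBy hK).one_sub))
  rw [Complex.zero_re, Matrix.mul_sub, Matrix.mul_one, trace_sub, h.trace_choi, Matrix.mul_smul,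
    trace_smul, smul_eq_mul, ← Complex.ofReal_natCast, ← Complex.ofReal_inv, Complex.sub_re,
    Complex.re_ofReal_mul, Complex.ofReal_re, sub_nonneg,
    inv_mul_le_iff₀ (Nat.cast_pos.mpr Fintype.card_pos)] at h_nonneg
  rwa [sq]

theorem trace_choi_mul_choi_conjBy_of_convex {K : Matrix a a ℂ} (hK : Kᴴ * K = 1)
    {Φ Ψ : OpMap a a} (hΦ : IsChannel Φ) (hΨ : IsChannel Ψ) {p : ℝ} (hp : p ∈ Set.Ioc 0 1)
    (h : conjBy K = (p : ℂ) • Φ + ((1 - p : ℝ) : ℂ) • Ψ) :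
    ((choi Φ * choi (conjBy K)).trace).re = (Fintype.card a : ℝ) ^ 2 := by
  have h_le := hΦ.trace_choi_mul_choi_conjBy_le hK
  have h_le' := hΨ.trace_choi_mul_choi_conjBy_le hK
  have h_choi : choi (conjBy K) = (p : ℂ) • choi Φ + ((1 - p : ℝ) : ℂ) • choi Ψ := by
    rw [h, choi_add, choi_smul, choi_smul]
  have h_trace : p * ((choi Φ * choi (conjBy K)).trace).re +
      (1 - p) * ((choi Ψ * choi (conjBy K)).trace).re = (Fintype.card a : ℝ) ^ 2 := by
    rw [← Complex.re_ofReal_mul, ← Complex.re_ofReal_mul, ← smul_eq_mul (p : ℂ),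
      ← smul_eq_mul ((1 - p : ℝ) : ℂ), ← trace_smul, ← trace_smul, ← Complex.add_re, ← trace_add,
      ← Matrix.smul_mul, ← Matrix.smul_mul, ← Matrix.add_mul, ← h_choi,
      trace_choi_conjBy_mul_self hK]
    norm_cast
  refine le_antisymm h_le (le_of_mul_le_mul_left ?_ hp.1)
  linarith [mul_le_mul_of_nonneg_left h_le' (sub_nonneg.mpr hp.2)]

end Fidelity

section NoGo

variable {d : ℕ}

theorem IsSupermap.exists_transposeFidelity_ne_one (hd : 2 ≤ d)
    {S : OpMap (Fin d × Fin d) (Fin d × Fin d) →ₗ[ℂ] OpMap (Fin d) (Fin d)} (hS : IsSupermap S) :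
    ∃ U ∈ unitaryGroup (Fin d) ℂ, transposeFidelity S U ≠ 1 := by
  by_contra! h
  let _ : MeasurableSpace (unitaryGroup (Fin d) ℂ) := borel _
  have : BorelSpace (unitaryGroup (Fin d) ℂ) := ⟨rfl⟩
  let μ : Measure (unitaryGroup (Fin d) ℂ) := Measure.haarMeasure ⊤
  have : IsProbabilityMeasure μ := ⟨Measure.haarMeasure_self⟩
  have h_integral : ∫ U : unitaryGroup (Fin d) ℂ, transposeFidelity S U.1 ∂μ = 1 := by
    simp [h _ (Subtype.prop _)]
  rcases hd.lt_or_eq with hd | rfl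
  · have h_le := hS.integral_transposeFidelity_le_of_two_lt hd μ
    rw [h_integral, le_div_iff₀ (by positivity)] at h_le
    have : (3 : ℝ) ≤ d := mod_cast hd
    nlinarith
  · have h_le := hS.integral_transposeFidelity_le_of_eq_two μ
    rw [h_integral] at h_le
    norm_num at h_le

theorem IsSupermap.exists_conjBy_transpose_ne (hd : 2 ≤ d)
    {S : OpMap (Fin d × Fin d) (Fin d × Fin d) →ₗ[ℂ] OpMap (Fin d) (Fin d)} (hS : IsSupermap S) :
    ∃ U ∈ unitaryGroup (Fin d) ℂ, ∀ p ∈ Set.Ioc (0 : ℝ) 1, ∀ Ψ, IsChannel Ψ →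
      conjBy Uᵀ ≠ (p : ℂ) • forward S (conjBy U) (conjBy U) + ((1 - p : ℝ) : ℂ) • Ψ := by
  obtain ⟨U, hU, h_ne⟩ := hS.exists_transposeFidelity_ne_one hd
  refine ⟨U, hU, fun p hp Ψ hΨ h => h_ne ?_⟩
  have h_conj := isChannel_conjBy (mem_unitaryGroup_iff'.mp hU)
  have h_transpose := mem_unitaryGroup_iff'.mp (transpose_mem_unitaryGroup_iff.mpr hU)
  rw [transposeFidelity, forward, trace_choi_mul_choi_conjBy_of_convex h_transpose
    (hS.1 _ (isNoSignalling_tensorMap h_conj h_conj)) hΨ hp h, Fintype.card_fin,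
    div_self (by positivity)]

variable {a : Type} [Fintype a] [DecidableEq a]

theorem theta_apply (W C : Matrix a a ℂ) : theta W C = W * Cᵀ * Wᴴ := rfl

theorem theta_mem_unitaryGroup {W U : Matrix a a ℂ} (hW : W ∈ unitaryGroup a ℂ)
    (hU : U ∈ unitaryGroup a ℂ) : theta W U ∈ unitaryGroup a ℂ :=
  mul_mem (mul_mem hW (transpose_mem_unitaryGroup_iff.mpr hU)) (Unitary.star_mem hW)

theorem conjTranspose_mul_theta_mul {W : Matrix a a ℂ} (hW : W ∈ unitaryGroup a ℂ)
    (C : Matrix a a ℂ) : Wᴴ * theta W C * W = Cᵀ := by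
  have h_unit : Wᴴ * W = 1 := mem_unitaryGroup_iff'.mp hW
  simp only [theta_apply, Matrix.mul_assoc, h_unit, Matrix.mul_one]
  rw [← Matrix.mul_assoc, h_unit, Matrix.one_mul]

theorem theta_theta_transpose {W : Matrix a a ℂ} (hW : W ∈ unitaryGroup a ℂ)
    (C : Matrix a a ℂ) : theta W (theta Wᵀ C) = C := by
  have h_unit : W * Wᴴ = 1 := mem_unitaryGroup_iff.mp hW
  have h_transpose : Wᵀᴴᵀ = Wᴴ := rfl
  simp only [theta_apply, transpose_mul, transpose_transpose, h_transpose, Matrix.mul_assoc,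
    h_unit, Matrix.mul_one]
  rw [← Matrix.mul_assoc, h_unit, Matrix.one_mul]

theorem backward_conjBy {Ci Co : Type} (W U V : Matrix a a ℂ)
    (S : OpMap (a × a) (a × a) →ₗ[ℂ] OpMap Ci Co) :
    backward W S (conjBy U) (conjBy V) =
      forward S (conjBy (theta W U)) (conjBy (theta W V)) := by
  rw [backward, forward, inversion, liftKraus_conjBy, liftKraus_conjBy]

theorem exists_timeFlip_conjBy_ne_convex (hd : 2 ≤ d) {W : Matrix (Fin d) (Fin d) ℂ}
    (hW : W ∈ unitaryGroup (Fin d) ℂ) {p : ℝ} (hp : p ∈ Set.Icc (0 : ℝ) 1)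
    {Sf Sb : OpMap (Fin d × Fin d) (Fin d × Fin d) →ₗ[ℂ] OpMap (Fin d × Fin 2) (Fin d × Fin 2)}
    (hSf : IsSupermap Sf) (hSb : IsSupermap Sb) :
    ∃ U ∈ unitaryGroup (Fin d) ℂ, timeFlip W (conjBy U) ≠
      (p : ℂ) • forward Sf (conjBy U) (conjBy U) +
        ((1 - p : ℝ) : ℂ) • backward W Sb (conjBy U) (conjBy U) := by
  rcases hp.1.eq_or_lt with rfl | hp0
  · have hWt := transpose_mem_unitaryGroup_iff.mpr hW
    obtain ⟨V, hV, h_ne⟩ := (hSb.controlMap_comp hWt 0).exists_conjBy_transpose_ne hd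
    refine ⟨theta Wᵀ V, theta_mem_unitaryGroup hWt hV, fun h =>
      h_ne 1 (by simp) LinearMap.id isChannel_id ?_⟩
    have h_control := congrArg (controlMap Wᵀ 0) h
    rw [controlMap_timeFlip_conjBy, if_pos rfl, conjTranspose_mul_theta_mul hWt, backward_conjBy,
      theta_theta_transpose hW] at h_control
    simpa [forward] using h_control
  · obtain ⟨U, hU, h_ne⟩ := (hSf.controlMap_comp hW 1).exists_conjBy_transpose_ne hd
    have h_theta := isChannel_conjBy (mem_unitaryGroup_iff'.mp (theta_mem_unitaryGroup hW hU))
    refine ⟨U, hU, fun h => h_ne p ⟨hp0, hp.2⟩ _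
      ((hSb.1 _ (isNoSignalling_tensorMap h_theta h_theta)).controlMap hW 1) ?_⟩
    have h_control := congrArg (controlMap W 1) h
    rw [controlMap_timeFlip_conjBy, if_neg one_ne_zero, conjTranspose_mul_theta_mul hW,
      backward_conjBy, map_add, map_smul, map_smul] at h_control
    exact h_control

end NoGo

end TimeFlip

theorem theorem3 (d : ℕ) (hd : 2 ≤ d) :
    (∀ W ∈ Matrix.unitaryGroup (Fin d) ℂ,
      ¬ ∃ p ∈ Set.Icc (0 : ℝ) 1,
        ∃ Sf Sb : TimeFlip.OpMap (Fin d × Fin d) (Fin d × Fin d) →ₗ[ℂ]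
            TimeFlip.OpMap (Fin d × Fin 2) (Fin d × Fin 2),
          TimeFlip.IsSupermap Sf ∧ TimeFlip.IsSupermap Sb ∧
          ∀ U ∈ Matrix.unitaryGroup (Fin d) ℂ,
            TimeFlip.timeFlip W (TimeFlip.conjBy U) =
              (p : ℂ) • TimeFlip.forward Sf (TimeFlip.conjBy U) (TimeFlip.conjBy U) +
              ((1 - p : ℝ) : ℂ) •
                TimeFlip.backward W Sb (TimeFlip.conjBy U) (TimeFlip.conjBy U)) ∧
    (∀ [MeasurableSpace (Matrix.unitaryGroup (Fin d) ℂ)]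
        [BorelSpace (Matrix.unitaryGroup (Fin d) ℂ)]
        (μ : Measure (Matrix.unitaryGroup (Fin d) ℂ)) [IsProbabilityMeasure μ] [μ.IsHaarMeasure]
        (S : TimeFlip.OpMap (Fin d × Fin d) (Fin d × Fin d) →ₗ[ℂ]
          TimeFlip.OpMap (Fin d) (Fin d)), TimeFlip.IsSupermap S →
      Integrable (fun U : Matrix.unitaryGroup (Fin d) ℂ =>
        TimeFlip.transposeFidelity S (U : Matrix (Fin d) (Fin d) ℂ)) μ ∧
      (2 < d → ∫ U : Matrix.unitaryGroup (Fin d) ℂ,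
        TimeFlip.transposeFidelity S (U : Matrix (Fin d) (Fin d) ℂ) ∂μ ≤ 6 / (d : ℝ) ^ 2) ∧
      (d = 2 → ∫ U : Matrix.unitaryGroup (Fin d) ℂ,
        TimeFlip.transposeFidelity S (U : Matrix (Fin d) (Fin d) ℂ) ∂μ ≤ 5 / 6)) := by
  refine ⟨fun W hW ⟨p, hp, Sf, Sb, hSf, hSb, h⟩ => ?_, fun {_} {_} μ _ _ S hS =>
    ⟨TimeFlip.integrable_transposeFidelity S μ,
      fun hd => hS.integral_transposeFidelity_le_of_two_lt hd μ, ?_⟩⟩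
  · obtain ⟨U, hU, h_ne⟩ := TimeFlip.exists_timeFlip_conjBy_ne_convex hd hW hp hSf hSb
    exact h_ne (h U hU)
  · rintro rfl
    exact hS.integral_transposeFidelity_le_of_eq_two μ
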